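/- Throughout, $\mathbb{K}$ is a commutative ring and, for $n\in\mathbb{N}$, $\mathbf{B}_n$ is the braid group on $n$ strands with Artin generators $\sigma_1,\dots,\sigma_{n-1}$ (trivial for $n\le 1$), $\mathbf{F}_n$ is the free group on $g_1,\dots,g_n$, and $\sigma'\natural\sigma\in\mathbf{B}_{m+n}$ is the juxtaposition of $\sigma'\in\mathbf{B}_m$ (on the left) and $\sigma\in\mathbf{B}_n$ (on the right). The braiding is $$b_{n,m}=(\sigma_m\cdots\sigma_2\sigma_1)\cdots(\sigma_{n+m-2}\cdots\sigma_{n-1})(\sigma_{n+m-1}\cdots\sigma_n)\in\mathbf{B}_{n+m}.$$ **The category $\mathfrak{U}\boldsymbol\beta$.** Its objects are the natural numbers. There is no morphism $n\to n'$ if $n'<n$. If $n\le n'$, the morphisms $n\to n'$ are the classes $[n'-n,f]$ of elements $f\in\mathbf{B}_{n'}$, where $f\sim f'$ if and only if $f=f'\,(\psi\natural \mathrm{id}_n)$ for some $\psi\in\mathbf{B}_{n'-n}$. Composition is $[n''-n',g]\circ[n'-n,f]=[n''-n,\,g\,(\mathrm{id}_{n''-n'}\natural f)]$. A braid $\sigma\in\mathbf{B}_n$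 is viewed as the automorphism $[0,\sigma]$ of $n$. For every $x\in\mathbb{N}$ there is an endofunctor $x\natural-$ with $x\natural n=x+n$ and $$\mathrm{id}_x\natural[n'-n,f]=[n'-n,\ (\mathrm{id}_x\natural f)\,((b_{x,n'-n})^{-1}\natural\mathrm{id}_n)],$$ and the unique morphism $\iota_x:0\to x$ gives natural morphisms $\iota_x\natural\mathrm{id}_n=[x,\mathrm{id}_{x+n}]:n\to x\natural n$. **Coherent and reliable families.** Let $a_n:\mathbf{B}_n\to\mathrm{Aut}(\mathbf{F}_n)$ and $\varsigma_n:\mathbf{F}_n\to\mathbf{B}_{1+n}$ ($n\in\mathbb{N}$) be group morphisms. For $n\le n'$ let $\iota_{\mathbf{F}_{n'-n}}*\mathrm{id}_{\mathbf{F}_n}:\mathbf{F}_n\to\mathbf{F}_{n'}$, $g\mapsto e*g$, send the generators to the last $n$ generators of $\mathbf{F}_{n'}$, in order, and let $\mathrm{id}_{\mathbf{F}_n}*\iota_{\mathbf{F}_{n'-n}}:\mathbf{F}_n\to\mathbf{F}_{n'}$ send them to the first $n$ generators. The families $a$, $\varsigma$ are *coherent* if for all $n\le n'$, $g\in\mathbf{F}_n$,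 $\sigma\in\mathbf{B}_n$ and $\sigma'\in\mathbf{B}_{n'-n}$: 1. $(\mathrm{id}_1\natural[n'-n,\mathrm{id}_{n'}])\circ\varsigma_n(g)=\varsigma_{n'}(e*g)\circ(\mathrm{id}_1\natural[n'-n,\mathrm{id}_{n'}])$ in $\mathfrak{U}\boldsymbol\beta$; 2. $(\iota_{\mathbf{F}_{n'-n}}*\mathrm{id}_{\mathbf{F}_n})\circ a_n(\sigma)=a_{n'}(\sigma'\natural\sigma)\circ(\iota_{\mathbf{F}_{n'-n}}*\mathrm{id}_{\mathbf{F}_n})$; 3. $(\mathrm{id}_1\natural\sigma)\,\varsigma_n(g)=\varsigma_n(a_n(\sigma)(g))\,(\mathrm{id}_1\natural\sigma)$ in $\mathbf{B}_{1+n}$. Coherent families are *reliable* if moreover for all $n\le n'$ and $\sigma\in\mathbf{B}_n$: 4. $a_{1+n'}((b_{1,n'-n})^{-1}\natural\mathrm{id}_n)\circ(\iota_{\mathbf{F}_{n'-n}}*\mathrm{id}_{\mathbf{F}_{1+n}})\circ(\mathrm{id}_{\mathbf{F}_1}*\iota_{\mathbf{F}_n})=\mathrm{id}_{\mathbf{F}_1}*\iota_{\mathbf{F}_{n'}}$;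 5. $a_{n'}(\mathrm{id}_{n'-n}\natural\sigma)\circ(\mathrm{id}_{\mathbf{F}_{n'-n}}*\iota_{\mathbf{F}_n})=\mathrm{id}_{\mathbf{F}_{n'-n}}*\iota_{\mathbf{F}_n}$. **The Long-Moody functor.** For coherent $a$, $\varsigma$ and a functor $F:\mathfrak{U}\boldsymbol\beta\to\mathbb{K}\text{-}\mathfrak{Mod}$, the functor $\mathbf{LM}_{a,\varsigma}(F):\mathfrak{U}\boldsymbol\beta\to\mathbb{K}\text{-}\mathfrak{Mod}$ is given on objects by $$\mathbf{LM}_{a,\varsigma}(F)(n)=\mathcal{I}_{\mathbb{K}[\mathbf{F}_n]}\otimes_{\mathbb{K}[\mathbf{F}_n]}F(1+n),$$ where $\mathcal{I}_{\mathbb{K}[\mathbf{F}_n]}$ is the augmentation ideal of the group ring and $\mathbf{F}_n$ acts on $F(1+n)$ through $\varsigma_n$, and on morphisms by $$\mathbf{LM}_{a,\varsigma}(F)([n'-n,\sigma])(i\otimes v)=a_{n'}(\sigma)(e*i)\otimes F(\mathrm{id}_1\natural[n'-n,\sigma])(v),$$ where $e*-$ and $a_{n'}(\sigma)$ are extended linearly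 to the augmentation ideals; on a natural transformation $\eta$ it is $i\otimes v\mapsto i\otimes\eta_{1+n}(v)$. **Polynomial functors.** For $F:\mathfrak{U}\boldsymbol\beta\to\mathbb{K}\text{-}\mathfrak{Mod}$ and $x\in\mathbb{N}$ put $\tau_x(F)=F(x\natural-)$, let $i_x:F\to\tau_x(F)$ be the natural transformation with components $F(\iota_x\natural\mathrm{id}_n)$, and put $\kappa_x(F)=\ker(i_x)$ and $\delta_x(F)=\mathrm{coker}(i_x)$. The functor $F$ is *strong polynomial of degree $\le n$* if $n<0$ and $F=0$, or if $n\ge0$ and $\delta_x(F)$ is strong polynomial of degree $\le n-1$ for all $x$. It is *very strong polynomial of degree $\le n$* if $n<0$ and $F=0$, or if $n\ge0$, $F$ is strong polynomial of degree $\le n$ and for all $x$ one has $\kappa_x(F)=0$ and $\delta_x(F)$ is very strong polynomial of degree $\le n-1$. It is *very strong polynomial of degree equal to $d\in\mathbb{N}$* if $d$ is the smallest natural number such that $F$ is very strong polynomial of degree $\le d$. **Theorem B.** Let $a$, $\varsigma$ be coherent reliable families, let $d\in\mathbb{N}$, and let $F:\mathfrak{U}\boldsymbol\beta\to\mathbb{K}\text{-}\mathfrak{Mod}$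 be a nonzero functor which is very strong polynomial of degree equal to $d$. Then $\mathbf{LM}_{a,\varsigma}(F)$ is very strong polynomial of degree equal to $d+1$. -/

import Mathlib

open CategoryTheory CategoryTheory.Limits

universe u v w

namespace LongMoody

/-! ## Braid groups -/

/-- The defining relators of the braid group on `n` strands. The Artin generators are indexed from
`0`: the generator of index `i` is usually written `σ_{i+1}`. -/
def braidRels (n : ℕ) : Set (FreeGroup (Fin (n - 1))) :=
  {r | (∃ i j : Fin (n - 1), (j : ℕ) = i + 1 ∧
          r = FreeGroup.of i * FreeGroup.of j * FreeGroup.of i *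
            (FreeGroup.of j * FreeGroup.of i * FreeGroup.of j)⁻¹) ∨
       (∃ i j : Fin (n - 1), (i : ℕ) + 2 ≤ j ∧
          r = FreeGroup.of i * FreeGroup.of j * (FreeGroup.of j * FreeGroup.of i)⁻¹)}

/-- The braid group on `n` strands, by Artin's presentation (trivial for `n = 0, 1`). -/
abbrev BraidGroup (n : ℕ) : Type := PresentedGroup (braidRels n)

namespace BraidGroup

/-- The Artin generator of index `i` (usually written `σ_{i+1}`) of the braid group on `n` strands;
by convention it is `1` when `n` is too small for it to exist. -/
def sigma (n i : ℕ) : BraidGroup n :=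
  if h : i < n - 1 then PresentedGroup.of ⟨i, h⟩ else 1

theorem sigma_braid (n i : ℕ) (h : i + 2 < n) :
    sigma n i * sigma n (i + 1) * sigma n i = sigma n (i + 1) * sigma n i * sigma n (i + 1) := by
  have h1 : i < n - 1 := by omega
  have h2 : i + 1 < n - 1 := by omega
  simp only [sigma, h1, h2, dite_true]
  refine PresentedGroup.mk_eq_mk_of_mul_inv_mem (rels := braidRels n) (x := FreeGroup.of ⟨i, h1⟩ *
    FreeGroup.of ⟨i + 1, h2⟩ * FreeGroup.of ⟨i, h1⟩) (y := FreeGroup.of ⟨i + 1, h2⟩ *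
    FreeGroup.of ⟨i, h1⟩ * FreeGroup.of ⟨i + 1, h2⟩) (Or.inl ⟨⟨i, h1⟩, ⟨i + 1, h2⟩, rfl, rfl⟩)

theorem sigma_comm (n i j : ℕ) (hij : i + 2 ≤ j) :
    sigma n i * sigma n j = sigma n j * sigma n i := by
  by_cases h2 : j < n - 1
  · have h1 : i < n - 1 := by omega
    simp only [sigma, h1, h2, dite_true]
    exact PresentedGroup.mk_eq_mk_of_mul_inv_mem (rels := braidRels n) (x := FreeGroup.of ⟨i, h1⟩ *
      FreeGroup.of ⟨j, h2⟩) (y := FreeGroup.of ⟨j, h2⟩ * FreeGroup.of ⟨i, h1⟩)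
      (Or.inr ⟨⟨i, h1⟩, ⟨j, h2⟩, hij, rfl⟩)
  · simp [sigma, h2]

/-- The universal property of the presentation. -/
def lift {G : Type*} [Group G] (n : ℕ) (f : ℕ → G)
    (hb : ∀ i, i + 2 < n → f i * f (i + 1) * f i = f (i + 1) * f i * f (i + 1))
    (hc : ∀ i j, i + 2 ≤ j → j + 1 < n → f i * f j = f j * f i) : BraidGroup n →* G :=
  PresentedGroup.toGroup (rels := braidRels n) (f := fun i : Fin (n - 1) => f i) (by
    rintro r (⟨i, j, hij, rfl⟩ | ⟨i, j, hij, rfl⟩)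
    · have := hb i (by omega)
      simp only [map_mul, map_inv, FreeGroup.lift_apply_of, hij]
      rw [this, mul_inv_cancel]
    · have := hc i j hij (by omega)
      simp only [map_mul, map_inv, FreeGroup.lift_apply_of]
      rw [this, mul_inv_cancel])

theorem lift_sigma {G : Type*} [Group G] (n : ℕ) (f : ℕ → G)
    (hb : ∀ i, i + 2 < n → f i * f (i + 1) * f i = f (i + 1) * f i * f (i + 1))
    (hc : ∀ i j, i + 2 ≤ j → j + 1 < n → f i * f j = f j * f i) (i : ℕ) (h : i + 1 < n) :
    lift n f hb hc (sigma n i) = f i := by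
  have h1 : i < n - 1 := by omega
  simp only [sigma, h1, dite_true]
  exact PresentedGroup.toGroup.of _

theorem closure_sigma (n : ℕ) : Subgroup.closure {x | ∃ i, i + 1 < n ∧ x = sigma n i} = ⊤ := by
  rw [← PresentedGroup.closure_range_of (braidRels n)]
  congr 1
  ext x
  constructor
  · rintro ⟨i, hi, rfl⟩
    have h1 : i < n - 1 := by omega
    exact ⟨⟨i, h1⟩, by simp [sigma, h1]⟩
  · rintro ⟨i, rfl⟩
    exact ⟨i, by omega, by simp [sigma]⟩

theorem hom_ext {G : Type*} [Group G] {n : ℕ} {φ ψ : BraidGroup n →* G}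
    (h : ∀ i, i + 1 < n → φ (sigma n i) = ψ (sigma n i)) : φ = ψ :=
  MonoidHom.eq_of_eqOn_dense (closure_sigma n) (by rintro x ⟨i, hi, rfl⟩; exact h i hi)

/-- The inclusion of braid groups `σ ↦ id_k ♮ σ ♮ id_{m-n-k}`: a braid on `n` strands is laid beside
`k` trivial strands on its left and `m - n - k` trivial strands on its right. -/
def shift (k n m : ℕ) (h : k + n ≤ m) : BraidGroup n →* BraidGroup m :=
  lift n (fun i => sigma m (k + i))
    (fun i hi => by simpa [add_assoc] using sigma_braid m (k + i) (by omega))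
    (fun i j hij _ => sigma_comm m (k + i) (k + j) (by omega))

theorem shift_sigma (k n m : ℕ) (h : k + n ≤ m) (i : ℕ) (hi : i + 1 < n) :
    shift k n m h (sigma n i) = sigma m (k + i) := lift_sigma _ _ _ _ _ hi

theorem shift_shift (k n m l p : ℕ) (h : k + n ≤ m) (h' : l + m ≤ p) (x : BraidGroup n) :
    shift l m p h' (shift k n m h x) = shift (l + k) n p (by omega) x := by
  have : (shift l m p h').comp (shift k n m h) = shift (l + k) n p (by omega) :=
    hom_ext fun i hi => by
      simp [shift_sigma _ _ _ _ _ hi, shift_sigma l m p h' (k + i) (by omega), add_assoc]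
  exact DFunLike.congr_fun this x

theorem shift_self (n : ℕ) (h : 0 + n ≤ n) (x : BraidGroup n) : shift 0 n n h x = x := by
  have : shift 0 n n h = MonoidHom.id _ := hom_ext fun i hi => by simp [shift_sigma _ _ _ _ _ hi]
  exact DFunLike.congr_fun this x

/-- Braids on disjoint sets of consecutive strands commute. -/
theorem shift_comm (k n k' n' m : ℕ) (h : k + n ≤ m) (h' : k' + n' ≤ m) (hk : k + n ≤ k')
    (x : BraidGroup n) (y : BraidGroup n') :
    shift k n m h x * shift k' n' m h' y = shift k' n' m h' y * shift k n m h x := by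
  have key : ∀ i, i + 1 < n → ∀ y, shift k' n' m h' y * sigma m (k + i) =
      sigma m (k + i) * shift k' n' m h' y := by
    intro i hi y
    have : (MulAut.conj (sigma m (k + i))).toMonoidHom.comp (shift k' n' m h') =
        shift k' n' m h' := hom_ext fun j hj => by
      simp only [MonoidHom.comp_apply, shift_sigma _ _ _ _ _ hj, MulEquiv.coe_toMonoidHom,
        MulAut.conj_apply]
      rw [sigma_comm m (k + i) (k' + j) (by omega), mul_inv_cancel_right]
    have h2 := DFunLike.congr_fun this y
    simp only [MonoidHom.comp_apply, MulEquiv.coe_toMonoidHom, MulAut.conj_apply] at h2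
    rw [mul_inv_eq_iff_eq_mul] at h2
    exact h2.symm
  have : (MulAut.conj (shift k' n' m h' y)).toMonoidHom.comp (shift k n m h) = shift k n m h :=
    hom_ext fun i hi => by
      simp only [MonoidHom.comp_apply, shift_sigma _ _ _ _ _ hi, MulEquiv.coe_toMonoidHom,
        MulAut.conj_apply]
      rw [key i hi y, mul_inv_cancel_right]
  have h2 := DFunLike.congr_fun this x
  simp only [MonoidHom.comp_apply, MulEquiv.coe_toMonoidHom, MulAut.conj_apply] at h2
  rw [mul_inv_eq_iff_eq_mul] at h2
  exact h2.symm

/-- `juxt m n p σ τ` is `σ ♮ τ`, the braid `σ` on `m` strands laid on the left of the braid `τ` on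
`n` strands; here `p = m + n` is the total number of strands. -/
def juxt (m n p : ℕ) (h : p = m + n) (σ : BraidGroup m) (τ : BraidGroup n) : BraidGroup p :=
  shift 0 m p (by omega) σ * shift m n p (by omega) τ

/-- With Artin's indexing, `column N j m = σ_{j+m} ⋯ σ_{j+2} σ_{j+1}`. -/
def column (N j : ℕ) : ℕ → BraidGroup N
  | 0 => 1
  | m + 1 => sigma N (j + m) * column N j m

/-- `rows N m n = column N 0 m ⋯ column N (n-2) m * column N (n-1) m`. -/
def rows (N m : ℕ) : ℕ → BraidGroup N
  | 0 => 1
  | n + 1 => rows N m n * column N n m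

/-- The braiding `b_{n,m} : n ♮ m ⟶ m ♮ n`. With Artin's indexing it is
`(σ_m ⋯ σ_2 σ_1) ⋯ (σ_{n+m-2} ⋯ σ_n σ_{n-1}) (σ_{n+m-1} ⋯ σ_{n+1} σ_n)`. -/
def braiding (n m : ℕ) : BraidGroup (n + m) := rows (n + m) m n

theorem column_add (N j p q : ℕ) : column N j (p + q) = column N (j + p) q * column N j p := by
  induction q with
  | zero => simp [column]
  | succ q ih =>
    rw [← add_assoc]
    simp only [column, ih, mul_assoc, add_assoc]

theorem sigma_comm_column (N i j m : ℕ) (h : i + 2 ≤ j) :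
    sigma N i * column N j m = column N j m * sigma N i := by
  induction m with
  | zero => simp [column]
  | succ m ih =>
    simp only [column]
    rw [← mul_assoc, sigma_comm N i (j + m) (by omega), mul_assoc, ih, mul_assoc]

theorem column_comm_sigma (N i j m : ℕ) (h : j + m + 1 ≤ i) :
    sigma N i * column N j m = column N j m * sigma N i := by
  induction m with
  | zero => simp [column]
  | succ m ih =>
    simp only [column]
    rw [← mul_assoc, ← sigma_comm N (j + m) i (by omega), mul_assoc, ih (by omega), mul_assoc]

theorem column_mul_sigma (N j m i : ℕ) (hi : i + 1 < m) (hN : j + m < N) :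
    column N j m * sigma N (j + 1 + i) = sigma N (j + i) * column N j m := by
  obtain ⟨t, rfl⟩ : ∃ t, m = (i + 2) + t := ⟨m - (i + 2), by omega⟩
  have e1 : column N j (i + 2) = sigma N (j + i + 1) * (sigma N (j + i) * column N j i) := rfl
  have hb := sigma_braid N (j + i) (by omega)
  have hcol := column_comm_sigma N (j + i + 1) j i (by omega)
  have hfar := sigma_comm_column N (j + i) (j + (i + 2)) t (by omega)
  rw [column_add, show j + 1 + i = j + i + 1 by omega]
  rw [← mul_assoc (sigma N (j + i)), hfar, mul_assoc, mul_assoc]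
  congr 1
  rw [e1]
  calc sigma N (j + i + 1) * (sigma N (j + i) * column N j i) * sigma N (j + i + 1)
      = sigma N (j + i + 1) * sigma N (j + i) * (column N j i * sigma N (j + i + 1)) := by
        simp only [mul_assoc]
    _ = sigma N (j + i + 1) * sigma N (j + i) * sigma N (j + i + 1) * column N j i := by
        rw [← hcol]; simp only [mul_assoc]
    _ = _ := by rw [← hb]; simp only [mul_assoc]

theorem rows_mul_sigma (N m n i : ℕ) (hi : i + 1 < m) (hN : n + m ≤ N) :
    rows N m n * sigma N (n + i) = sigma N i * rows N m n := by
  induction n with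
  | zero => simp [rows]
  | succ n ih =>
    simp only [rows]
    rw [mul_assoc, column_mul_sigma N n m i hi (by omega), ← mul_assoc, ih (by omega), mul_assoc]

theorem rows_comm_sigma (N m n i : ℕ) (h : n + m ≤ i) :
    sigma N i * rows N m n = rows N m n * sigma N i := by
  induction n with
  | zero => simp [rows]
  | succ n ih =>
    simp only [rows]
    rw [← mul_assoc, ih (by omega), mul_assoc, column_comm_sigma N i n m (by omega), mul_assoc]

theorem rows_comm_column (N m n j t : ℕ) (h : n + m ≤ j) :
    column N j t * rows N m n = rows N m n * column N j t := by
  induction t with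
  | zero => simp [column]
  | succ t ih =>
    simp only [column]
    rw [mul_assoc, ih, ← mul_assoc, rows_comm_sigma N m n (j + t) (by omega), mul_assoc]

theorem shift_column (k n m : ℕ) (h : k + n ≤ m) (j t : ℕ) (ht : j + t < n) :
    shift k n m h (column n j t) = column m (k + j) t := by
  induction t with
  | zero => simp [column]
  | succ t ih =>
    simp only [column, map_mul]
    rw [ih (by omega), shift_sigma _ _ _ _ _ (by omega), add_assoc]

/-- A product of consecutive columns, starting with the column of index `p`. -/
theorem shift_rows (k n m : ℕ) (h : k + n ≤ m) (t r : ℕ) (ht : r + t ≤ n) :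
    shift k n m h (rows n t r) = (List.ofFn fun j : Fin r => column m (k + j) t).prod := by
  induction r with
  | zero => simp [rows]
  | succ r ih =>
    simp only [rows, map_mul]
    rw [ih (by omega), shift_column _ _ _ _ _ _ (by omega), List.ofFn_succ_last]
    simp

theorem rows_eq (m t r : ℕ) : rows m t r = (List.ofFn fun j : Fin r => column m j t).prod := by
  induction r with
  | zero => simp [rows]
  | succ r ih =>
    simp only [rows]
    rw [ih, List.ofFn_succ_last]
    simp

theorem shift_zero_braiding (x p m : ℕ) (h : 0 + (x + p) ≤ m) :
    shift 0 (x + p) m h (braiding x p) = rows m p x := by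
  rw [braiding, shift_rows _ _ _ _ _ _ le_rfl, rows_eq]
  simp

/-- One of the hexagon relations, in a braid group on possibly more strands. -/
theorem rows_add (N p q x : ℕ) (h : p + (x + q) ≤ N) :
    rows N (p + q) x = shift p (x + q) N h (braiding x q) * rows N p x := by
  rw [braiding, shift_rows _ _ _ _ _ _ le_rfl]
  clear h
  induction x with
  | zero => simp [rows]
  | succ x ih =>
    simp only [rows]
    rw [ih, column_add, List.ofFn_succ_last]
    simp only [List.prod_append, List.prod_singleton, Fin.val_castSucc, Fin.val_last]
    have := rows_comm_column N p x (x + p) q le_rfl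
    rw [add_comm p x]
    simp only [mul_assoc]
    rw [← mul_assoc (rows N p x), ← this]
    simp only [mul_assoc]

/-- Naturality of the braiding in its second variable, in a braid group on possibly more strands. -/
theorem rows_mul_shift (N x p : ℕ) (h : x + p ≤ N) (ψ : BraidGroup p) :
    rows N p x * shift x p N h ψ = shift 0 p N (by omega) ψ * rows N p x := by
  have : (MulAut.conj (rows N p x)).toMonoidHom.comp (shift x p N h) = shift 0 p N (by omega) :=
    hom_ext fun i hi => by
      simp only [MonoidHom.comp_apply, shift_sigma _ _ _ _ _ hi, MulEquiv.coe_toMonoidHom,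
        MulAut.conj_apply]
      rw [rows_mul_sigma N p x i hi h, mul_inv_cancel_right, zero_add]
  have h2 := DFunLike.congr_fun this ψ
  simp only [MonoidHom.comp_apply, MulEquiv.coe_toMonoidHom, MulAut.conj_apply] at h2
  rwa [mul_inv_eq_iff_eq_mul] at h2

end BraidGroup

/-! ## Quillen's bracket construction on the braid groupoid -/

/-- The objects of the category `𝔘β`: one for each natural number. -/
@[ext]
structure UBeta : Type where
  /-- the underlying natural number -/
  strands : ℕ

namespace UBeta

open BraidGroup

/-- The subgroup `{g ♮ id_n | g ∈ B_{n'-n}}` of `B_{n'}`. -/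
def leftBraids (n n' : ℕ) : Subgroup (BraidGroup n') := (shift 0 (n' - n) n' (by omega)).range

theorem shift_mem_leftBraids {n n' p : ℕ} (hp : p = n' - n) (h : 0 + p ≤ n') (ψ : BraidGroup p) :
    shift 0 p n' h ψ ∈ leftBraids n n' := by
  subst hp
  exact ⟨ψ, rfl⟩

/-- The morphisms from `n` to `n'` in `𝔘β`: there are none unless `n ≤ n'`, and if `n ≤ n'` they are
the classes `[n' - n, f]` of braids `f ∈ B_{n'}`, where `f` and `f'` are identified if and only if
`f = f' (g ♮ id_n)` for some `g ∈ B_{n'-n}`. -/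
def Hom (n n' : ℕ) : Type := {_q : BraidGroup n' ⧸ leftBraids n n' // n ≤ n'}

/-- The morphism `[n' - n, f]` of `𝔘β`. -/
def cls {n n' : ℕ} (h : n ≤ n') (f : BraidGroup n') : Hom n n' := ⟨QuotientGroup.mk f, h⟩

theorem cls_eq {n n' : ℕ} (h : n ≤ n') {f f' : BraidGroup n'} (hf : f⁻¹ * f' ∈ leftBraids n n') :
    cls h f = cls h f' := Subtype.ext (QuotientGroup.eq.mpr hf)

theorem cls_surj {n n' : ℕ} (φ : Hom n n') : ∃ h f, φ = cls h f := by
  obtain ⟨q, h⟩ := φ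
  obtain ⟨f, rfl⟩ := QuotientGroup.mk_surjective q
  exact ⟨h, f, rfl⟩

/-- Composition in `𝔘β`: `[n'' - n', g] ∘ [n' - n, f] = [n'' - n, g (id_{n''-n'} ♮ f)]`. -/
def comp {n n' n'' : ℕ} (φ : Hom n n') (χ : Hom n' n'') : Hom n n'' :=
  ⟨Quotient.map₂ (sa := QuotientGroup.leftRel (leftBraids n n'))
    (sb := QuotientGroup.leftRel (leftBraids n' n''))
    (sc := QuotientGroup.leftRel (leftBraids n n''))
    (fun f g => g * shift (n'' - n') n' n'' (by have := χ.2; omega) f) (by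
      have h1 := φ.2
      have h2 := χ.2
      intro f f' hf g g' hg
      obtain ⟨x, hx⟩ := QuotientGroup.leftRel_apply.mp hf
      obtain ⟨y, hy⟩ := QuotientGroup.leftRel_apply.mp hg
      refine QuotientGroup.leftRel_apply.mpr ?_
      obtain rfl : g' = g * shift 0 (n'' - n') n'' (by omega) y := by
        rw [hy, mul_inv_cancel_left]
      obtain rfl : f' = f * shift 0 (n' - n) n' (by omega) x := by
        rw [hx, mul_inv_cancel_left]
      rw [map_mul, shift_shift, mul_inv_rev]
      have e : (shift (n'' - n') n' n'' (by omega) f)⁻¹ * g⁻¹ *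
          (g * shift 0 (n'' - n') n'' (by omega) y * (shift (n'' - n') n' n'' (by omega) f *
            shift (n'' - n' + 0) (n' - n) n'' (by omega) x)) =
          shift 0 (n'' - n') n'' (by omega) y *
            shift (n'' - n' + 0) (n' - n) n'' (by omega) x := by
        rw [← mul_assoc (g * _), mul_assoc g, shift_comm _ _ _ _ _ _ _ (by omega)]
        group
      rw [e]
      refine mul_mem ?_ ?_
      · have := shift_shift 0 (n'' - n') (n'' - n) 0 n'' (by omega) (by omega) y
        rw [← this]
        exact ⟨_, rfl⟩
      · have := shift_shift (n'' - n') (n' - n) (n'' - n) 0 n'' (by omega) (by omega) x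
        simp only [zero_add] at this
        simp only [add_zero]
        rw [← this]
        exact ⟨_, rfl⟩) φ.1 χ.1, φ.2.trans χ.2⟩

theorem cls_comp_cls {n n' n'' : ℕ} (h : n ≤ n') (h' : n' ≤ n'') (f : BraidGroup n')
    (g : BraidGroup n'') : comp (cls h f) (cls h' g) =
      cls (h.trans h') (g * shift (n'' - n') n' n'' (by omega) f) := rfl

theorem shift_congr {k k' n m : ℕ} (hk : k = k') (h : k + n ≤ m) (x : BraidGroup n) :
    shift k n m h x = shift k' n m (by omega) x := by
  subst hk
  rfl

theorem shift_braiding_congr {p p' x k N : ℕ} (hp : p = p') (h : k + (x + p) ≤ N) :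
    shift k (x + p) N h (braiding x p) = shift k (x + p') N (by omega) (braiding x p') := by
  subst hp
  rfl

/-- The category `𝔘β`. -/
instance : Category UBeta where
  Hom n n' := Hom n.strands n'.strands
  id n := cls le_rfl 1
  comp φ χ := comp φ χ
  id_comp φ := by
    obtain ⟨h, f, rfl⟩ := cls_surj φ
    rw [cls_comp_cls]
    simp
  comp_id φ := by
    obtain ⟨h, f, rfl⟩ := cls_surj φ
    rw [cls_comp_cls, shift_congr (Nat.sub_self _) (by omega), shift_self, one_mul]
  assoc φ χ ω := by
    obtain ⟨h, f, rfl⟩ := cls_surj φ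
    obtain ⟨h', g, rfl⟩ := cls_surj χ
    obtain ⟨h'', k, rfl⟩ := cls_surj ω
    rename_i n₀ n₁ n₂ n₃
    simp only [cls_comp_cls, map_mul, shift_shift, mul_assoc]
    rw [shift_congr (show n₃.strands - n₂.strands + (n₂.strands - n₁.strands) =
      n₃.strands - n₁.strands by omega)]

/-- The morphism `[n' - n, f]` of `𝔘β`, as a morphism of the category. -/
def hom {n n' : ℕ} (h : n ≤ n') (f : BraidGroup n') : (⟨n⟩ : UBeta) ⟶ ⟨n'⟩ := cls h f

theorem hom_surj {n n' : UBeta} (φ : n ⟶ n') : ∃ h f, φ = hom h f := cls_surj φ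

theorem hom_comp_hom {n n' n'' : ℕ} (h : n ≤ n') (h' : n' ≤ n'') (f : BraidGroup n')
    (g : BraidGroup n'') : hom h f ≫ hom h' g =
      hom (h.trans h') (g * shift (n'' - n') n' n'' (by omega) f) := rfl

theorem le_of_hom {n n' : UBeta} (φ : n ⟶ n') : n.strands ≤ n'.strands := φ.2

/-- A braid `σ ∈ B_n`, seen as the automorphism `[0, σ]` of `n` in `𝔘β`. -/
def braid {n : ℕ} (σ : BraidGroup n) : (⟨n⟩ : UBeta) ⟶ ⟨n⟩ := hom le_rfl σ

theorem hom_comp_braid {n n' : ℕ} (h : n ≤ n') (f σ : BraidGroup n') :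
    hom h f ≫ braid σ = hom h (σ * f) := by
  rw [braid, hom_comp_hom, shift_congr (Nat.sub_self _) (by omega), shift_self]

theorem braid_mul {n : ℕ} (σ τ : BraidGroup n) : braid (σ * τ) = braid τ ≫ braid σ :=
  (hom_comp_braid _ _ _).symm

theorem braid_one {n : ℕ} : braid (1 : BraidGroup n) = 𝟙 _ := rfl

/-- The class of the braid `(id_x ♮ f) ((b_{x,n'-n})⁻¹ ♮ id_n)`. -/
def tensorMap (x : ℕ) {n n' : ℕ} (φ : Hom n n') : Hom (x + n) (x + n') :=
  ⟨Quotient.map (sa := QuotientGroup.leftRel (leftBraids n n'))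
    (sb := QuotientGroup.leftRel (leftBraids (x + n) (x + n')))
    (fun f => shift x n' (x + n') le_rfl f *
      (shift 0 (x + (n' - n)) (x + n') (by have := φ.2; omega) (braiding x (n' - n)))⁻¹) (by
      have h1 := φ.2
      intro f f' hf
      obtain ⟨ψ, hψ⟩ := QuotientGroup.leftRel_apply.mp hf
      refine QuotientGroup.leftRel_apply.mpr ?_
      obtain rfl : f' = f * shift 0 (n' - n) n' (by omega) ψ := by
        rw [hψ, mul_inv_cancel_left]
      rw [map_mul, shift_shift, shift_zero_braiding]
      have := rows_mul_shift (x + n') x (n' - n) (by omega) ψ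
      simp only [add_zero]
      rw [mul_inv_rev, inv_inv]
      have e : rows (x + n') (n' - n) x * (shift x n' (x + n') le_rfl f)⁻¹ *
          (shift x n' (x + n') le_rfl f * shift x (n' - n) (x + n') (by omega) ψ *
            (rows (x + n') (n' - n) x)⁻¹) = shift 0 (n' - n) (x + n') (by omega) ψ := by
        calc _ = rows (x + n') (n' - n) x * shift x (n' - n) (x + n') (by omega) ψ *
            (rows (x + n') (n' - n) x)⁻¹ := by group
          _ = _ := by rw [this, mul_inv_cancel_right]
      rw [e]
      exact shift_mem_leftBraids (by omega) _ _) φ.1, by have := φ.2; omega⟩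

theorem tensorMap_cls (x : ℕ) {n n' : ℕ} (h : n ≤ n') (f : BraidGroup n') :
    tensorMap x (cls h f) = cls (by omega) (shift x n' (x + n') le_rfl f *
      (shift 0 (x + (n' - n)) (x + n') (by omega) (braiding x (n' - n)))⁻¹) := rfl

/-- The endofunctor `x ♮ -` of `𝔘β` given by the monoidal structure: it maps `n` to `x ♮ n = x + n`
and `[n' - n, f]` to
`id_x ♮ [n' - n, f] = [n' - n, (id_x ♮ f) ((b_{x,n'-n})⁻¹ ♮ id_n)]`. -/
def tensorLeft (x : ℕ) : UBeta ⥤ UBeta where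
  obj n := ⟨x + n.strands⟩
  map φ := tensorMap x φ
  map_id n := by
    change tensorMap x (cls _ _) = cls _ _
    rw [tensorMap_cls, shift_zero_braiding]
    congr 1
    have : ∀ r, rows (x + n.strands) 0 r = 1 := by
      intro r
      induction r with
      | zero => rfl
      | succ r ih => simp [rows, ih, column]
    rw [Nat.sub_self, this]
    simp
  map_comp {n n' n''} φ χ := by
    obtain ⟨h, f, rfl⟩ := cls_surj φ
    obtain ⟨h', g, rfl⟩ := cls_surj χ
    change tensorMap x (comp _ _) = comp (tensorMap x _) (tensorMap x _)
    rw [cls_comp_cls, tensorMap_cls, tensorMap_cls, tensorMap_cls, cls_comp_cls]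
    congr 1
    obtain ⟨n⟩ := n
    obtain ⟨n'⟩ := n'
    obtain ⟨n''⟩ := n''
    dsimp only at h h' f g ⊢
    obtain ⟨p, rfl⟩ := Nat.exists_eq_add_of_le h
    obtain ⟨q, rfl⟩ := Nat.exists_eq_add_of_le h'
    rw [shift_congr (k := x + (n + p + q) - (x + (n + p))) (k' := q) (by omega),
      shift_congr (k := n + p + q - (n + p)) (k' := q) (by omega)]
    rw [map_mul, map_mul, map_inv, shift_shift, shift_shift, shift_shift, shift_zero_braiding,
      shift_zero_braiding]
    have e3 : rows (x + (n + p + q)) (n + p + q - (n + p)) x = rows (x + (n + p + q)) q x := by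
      congr 1; omega
    rw [shift_braiding_congr (show n + p - n = p by omega),
      show n + p + q - n = q + p by omega, e3,
      rows_add _ q p x (by omega), shift_congr (add_zero q)]
    have hc := shift_comm 0 (x + q) (x + q) (n + p) (x + (n + p + q)) (by omega) (by omega)
      (by omega) (braiding x q) f
    rw [shift_zero_braiding] at hc
    have hc' : (rows (x + (n + p + q)) q x)⁻¹ * shift (x + q) (n + p) (x + (n + p + q))
        (by omega) f = shift (x + q) (n + p) (x + (n + p + q)) (by omega) f *
          (rows (x + (n + p + q)) q x)⁻¹ := by
      rw [inv_mul_eq_iff_eq_mul, ← mul_assoc, hc, mul_inv_cancel_right]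
    rw [shift_congr (show q + x = x + q by omega), mul_inv_rev]
    simp only [mul_assoc]
    rw [← mul_assoc (rows _ q x)⁻¹, hc']
    simp only [mul_assoc]

/-- The unique morphism `ι_x : 0 ⟶ x`, laid on the left of `id_n`: the morphisms
`ι_x ♮ id_n = [x, id_{x+n}] : n ⟶ x ♮ n` form a natural transformation from the identity functor to
`x ♮ -`. -/
def unitTensor (x : ℕ) : 𝟭 UBeta ⟶ tensorLeft x where
  app n := hom (n' := x + n.strands) (by omega) 1
  naturality n n' φ := by
    obtain ⟨n⟩ := n
    obtain ⟨n'⟩ := n'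
    obtain ⟨h, f, rfl⟩ := hom_surj φ
    change hom h f ≫ hom _ 1 = hom _ 1 ≫ hom _ _
    rw [hom_comp_hom, hom_comp_hom, map_one, one_mul, mul_one]
    refine cls_eq _ ?_
    dsimp only at h
    rw [shift_congr (show x + n' - n' = x by omega), inv_mul_cancel_left]
    have e : x + (n' - n) = x + n' - n := by omega
    exact inv_mem (shift_mem_leftBraids e _ _)

theorem tensorLeft_map_hom (x : ℕ) {n n' : ℕ} (h : n ≤ n') (f : BraidGroup n') :
    (tensorLeft x).map (hom h f) = hom (n := x + n) (n' := x + n') (by omega)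
      (shift x n' (x + n') le_rfl f *
        (shift 0 (x + (n' - n)) (x + n') (by omega) (braiding x (n' - n)))⁻¹) := rfl

theorem tensorLeft_map_braid (x : ℕ) {n n' : ℕ} (h : n ≤ n') (σ : BraidGroup n') :
    (tensorLeft x).map (hom h σ) =
      (tensorLeft x).map (hom h 1) ≫ braid (shift x n' (x + n') le_rfl σ) := by
  rw [tensorLeft_map_hom, tensorLeft_map_hom, map_one, one_mul]
  exact (hom_comp_braid _ _ _).symm

end UBeta

/-! ## Free groups and coherent families of morphisms -/

/-- `ι_{F_{n'-n}} * id_{F_n} : F_n → F_{n'}`, which identifies `F_n` with the subgroup of `F_{n'}`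
generated by the last `n` generators. -/
def freeLast {n n' : ℕ} (h : n ≤ n') : FreeGroup (Fin n) →* FreeGroup (Fin n') :=
  FreeGroup.map fun i => ⟨n' - n + i, by omega⟩

/-- `id_{F_n} * ι_{F_{n'-n}} : F_n → F_{n'}`, which identifies `F_n` with the subgroup of `F_{n'}`
generated by the first `n` generators. -/
def freeFirst {n n' : ℕ} (h : n ≤ n') : FreeGroup (Fin n) →* FreeGroup (Fin n') :=
  FreeGroup.map fun i => ⟨i, by omega⟩

theorem freeLast_self {n : ℕ} (h : n ≤ n) (x : FreeGroup (Fin n)) : freeLast h x = x := by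
  have : freeLast h = MonoidHom.id _ := by
    ext i
    simp [freeLast]
  rw [this]
  rfl

theorem freeLast_freeLast {n n' n'' : ℕ} (h : n ≤ n') (h' : n' ≤ n'') (x : FreeGroup (Fin n)) :
    freeLast h' (freeLast h x) = freeLast (h.trans h') x := by
  have : (freeLast h').comp (freeLast h) = freeLast (h.trans h') := by
    ext i
    simp only [freeLast, MonoidHom.comp_apply, FreeGroup.map.of]
    congr 2
    omega
  exact DFunLike.congr_fun this x

open BraidGroup UBeta

/-- Coherence of a family of actions `a_n : B_n → Aut(F_n)` and a family of morphisms
`ς_n : F_n → B_{1+n}`. -/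
structure Coherent (a : ∀ n : ℕ, BraidGroup n →* MulAut (FreeGroup (Fin n)))
    (ς : ∀ n : ℕ, FreeGroup (Fin n) →* BraidGroup (1 + n)) : Prop where
  /-- `(id_1 ♮ [n'-n, id_{n'}]) ∘ ς_n(g) = ς_{n'}(e * g) ∘ (id_1 ♮ [n'-n, id_{n'}])` in `𝔘β`. -/
  stability : ∀ (n n' : ℕ) (h : n ≤ n') (g : FreeGroup (Fin n)),
    braid (ς n g) ≫ (tensorLeft 1).map (hom h 1) =
      (tensorLeft 1).map (hom h 1) ≫ braid (ς n' (freeLast h g))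
  /-- `(ι_{F_{n'-n}} * id_{F_n}) ∘ a_n(σ) = a_{n'}(σ' ♮ σ) ∘ (ι_{F_{n'-n}} * id_{F_n})`. -/
  action : ∀ (n n' : ℕ) (h : n ≤ n') (σ : BraidGroup n) (σ' : BraidGroup (n' - n))
    (g : FreeGroup (Fin n)),
    freeLast h (a n σ g) = a n' (juxt (n' - n) n n' (by omega) σ' σ) (freeLast h g)
  /-- `(id_1 ♮ σ) ς_n(g) = ς_n(a_n(σ)(g)) (id_1 ♮ σ)` in `B_{1+n}`. -/
  compat : ∀ (n : ℕ) (σ : BraidGroup n) (g : FreeGroup (Fin n)),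
    juxt 1 n (1 + n) rfl 1 σ * ς n g = ς n (a n σ g) * juxt 1 n (1 + n) rfl 1 σ

/-- The additional conditions under which coherent families are called reliable; they only involve
the actions `a_n`. -/
structure Reliable (a : ∀ n : ℕ, BraidGroup n →* MulAut (FreeGroup (Fin n))) : Prop where
  /-- `a_{1+n'}((b_{1,n'-n})⁻¹ ♮ id_n) ∘ (ι_{F_{n'-n}} * id_{F_{1+n}}) ∘ (id_{F_1} * ι_{F_n})
  = id_{F_1} * ι_{F_{n'}}`. -/
  braiding : ∀ (n n' : ℕ) (h : n ≤ n') (g : FreeGroup (Fin 1)),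
    a (1 + n') (juxt (1 + (n' - n)) n (1 + n') (by omega) (braiding 1 (n' - n))⁻¹ 1)
      (freeLast (show 1 + n ≤ 1 + n' by omega) (freeFirst (show 1 ≤ 1 + n by omega) g)) =
        freeFirst (show 1 ≤ 1 + n' by omega) g
  /-- `a_{n'}(id_{n'-n} ♮ σ) ∘ (id_{F_{n'-n}} * ι_{F_n}) = id_{F_{n'-n}} * ι_{F_n}`. -/
  stabilizer : ∀ (n n' : ℕ) (h : n ≤ n') (σ : BraidGroup n) (g : FreeGroup (Fin (n' - n))),
    a n' (juxt (n' - n) n n' (by omega) 1 σ) (freeFirst (show n' - n ≤ n' by omega) g) =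
      freeFirst (show n' - n ≤ n' by omega) g

/-! ## Augmentation ideals and tensor products over group rings -/

noncomputable section Augmentation

open scoped TensorProduct

variable (K : Type u) [CommRing K] (G : Type v) [Group G]

/-- The augmentation ideal of the group ring `K[G]`: the kernel of the morphism `K[G] → K` which
maps every element of `G` to `1`. -/
def augIdeal : Submodule K (MonoidAlgebra K G) :=
  LinearMap.ker (MonoidAlgebra.lift K K G 1).toLinearMap

/-- The augmentation ideal, as a type. -/
def AugIdeal : Type _ := augIdeal K G

instance : AddCommGroup (AugIdeal K G) := inferInstanceAs (AddCommGroup (augIdeal K G))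

instance : Module K (AugIdeal K G) := inferInstanceAs (Module K (augIdeal K G))

variable {K G}

theorem mem_augIdeal {x : MonoidAlgebra K G} :
    x ∈ augIdeal K G ↔ MonoidAlgebra.lift K K G 1 x = 0 := Iff.rfl

/-- The right action of `K[G]` on its augmentation ideal, by multiplication. -/
def augMul (i : AugIdeal K G) (r : MonoidAlgebra K G) : AugIdeal K G :=
  ⟨i.1 * r, by rw [mem_augIdeal, map_mul, mem_augIdeal.mp i.2, zero_mul]⟩

variable {H : Type*} [Group H] {L : Type*} [Group L]

/-- The map between augmentation ideals induced by a group morphism. -/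
def augMap (φ : G →* H) : AugIdeal K G →ₗ[K] AugIdeal K H :=
  LinearMap.restrict (p := augIdeal K G) (q := augIdeal K H)
    (MonoidAlgebra.mapDomainAlgHom K K φ).toLinearMap fun x hx => by
    have : (MonoidAlgebra.lift K K H 1).comp (MonoidAlgebra.mapDomainAlgHom K K φ) =
        MonoidAlgebra.lift K K G 1 := by
      ext
      simp
    exact (DFunLike.congr_fun this x).trans hx

theorem coe_augMap (φ : G →* H) (i : AugIdeal K G) :
    (augMap φ i).1 = MonoidAlgebra.mapDomainAlgHom K K φ i.1 := rfl

theorem augMap_mul (φ : G →* H) (i : AugIdeal K G) (r : MonoidAlgebra K G) :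
    augMap φ (augMul i r) = augMul (augMap φ i) (MonoidAlgebra.mapDomainAlgHom K K φ r) :=
  Subtype.ext (map_mul (MonoidAlgebra.mapDomainAlgHom K K φ) _ _)

theorem augMap_id : augMap (MonoidHom.id G) = (LinearMap.id : AugIdeal K G →ₗ[K] AugIdeal K G) := by
  ext1 i
  refine Subtype.ext ?_
  rw [coe_augMap, MonoidAlgebra.mapDomainAlgHom_id]
  rfl

theorem augMap_comp (φ : G →* H) (χ : H →* L) (i : AugIdeal K G) :
    augMap (χ.comp φ) i = augMap χ (augMap φ i) := by
  refine Subtype.ext ?_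
  rw [coe_augMap, MonoidAlgebra.mapDomainAlgHom_comp]
  rfl

variable {M : Type*} [AddCommGroup M] [Module K M] {N : Type*} [AddCommGroup N] [Module K N]

/-- The relations `i r ⊗ m = i ⊗ r m` (with `r ∈ K[G]`) which have to be imposed on the tensor
product over `K` of the augmentation ideal with a representation of `G`. -/
def augRel (ρ : Representation K G M) : Submodule K (AugIdeal K G ⊗[K] M) :=
  Submodule.span K {t | ∃ (i : AugIdeal K G) (r : MonoidAlgebra K G) (m : M),
    t = augMul i r ⊗ₜ[K] m - i ⊗ₜ[K] ρ.asAlgebraHom r m}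

/-- The tensor product over `K[G]` of the augmentation ideal of `K[G]`, as a right module, with a
representation of `G`, as a left `K[G]`-module. -/
abbrev AugTensor (ρ : Representation K G M) : Type _ := (AugIdeal K G ⊗[K] M) ⧸ augRel ρ

namespace AugTensor

/-- The class `i ⊗ m`. -/
def tmul (ρ : Representation K G M) (i : AugIdeal K G) (m : M) : AugTensor ρ :=
  Submodule.Quotient.mk (i ⊗ₜ[K] m)

theorem hom_ext {P : Type*} [AddCommGroup P] [Module K P] {ρ : Representation K G M}
    {f g : AugTensor ρ →ₗ[K] P} (h : ∀ i m, f (tmul ρ i m) = g (tmul ρ i m)) : f = g := by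
  refine Submodule.linearMap_qext _ (TensorProduct.ext' fun i m => h i m)

/-- The map `i ⊗ m ↦ φ(i) ⊗ f(m)` induced by a group morphism `φ` and a linear map `f` which is
equivariant along `φ`. -/
def map {ρ : Representation K G M} {ρ' : Representation K H N} (φ : G →* H) (f : M →ₗ[K] N)
    (hf : ∀ g m, f (ρ g m) = ρ' (φ g) (f m)) : AugTensor ρ →ₗ[K] AugTensor ρ' :=
  Submodule.mapQ _ _ (TensorProduct.map (augMap φ) f) (by
    refine Submodule.span_le.mpr ?_
    rintro _ ⟨i, r, m, rfl⟩
    have key : f (ρ.asAlgebraHom r m) =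
        ρ'.asAlgebraHom (MonoidAlgebra.mapDomainAlgHom K K φ r) (f m) := by
      induction r using MonoidAlgebra.induction_on with
      | of g => simpa using hf g m
      | add x y hx hy => simp only [map_add, LinearMap.add_apply, hx, hy]
      | smul c x hx => simp only [map_smul, LinearMap.smul_apply, hx]
    refine Submodule.subset_span ⟨augMap φ i, MonoidAlgebra.mapDomainAlgHom K K φ r, f m, ?_⟩
    rw [map_sub, TensorProduct.map_tmul, TensorProduct.map_tmul, augMap_mul, key])

theorem map_tmul {ρ : Representation K G M} {ρ' : Representation K H N} (φ : G →* H) (f : M →ₗ[K] N)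
    (hf : ∀ g m, f (ρ g m) = ρ' (φ g) (f m)) (i : AugIdeal K G) (m : M) :
    map φ f hf (tmul ρ i m) = tmul ρ' (augMap φ i) (f m) := rfl

end AugTensor

end Augmentation

/-! ## The Long-Moody functor -/

noncomputable section LongMoodyFunctor

variable {a : ∀ n : ℕ, BraidGroup n →* MulAut (FreeGroup (Fin n))}
  {ς : ∀ n : ℕ, FreeGroup (Fin n) →* BraidGroup (1 + n)}

/-- For `φ = [n' - n, σ] : n ⟶ n'` in `𝔘β`, the group morphism
`a_{n'}(σ) ∘ (ι_{F_{n'-n}} * id_{F_n}) : F_n → F_{n'}`. -/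
def freeMap (hc : Coherent a ς) {n n' : UBeta} (φ : n ⟶ n') :
    FreeGroup (Fin n.strands) →* FreeGroup (Fin n'.strands) :=
  Quotient.lift (s := QuotientGroup.leftRel (leftBraids n.strands n'.strands))
    (fun σ => (a n'.strands σ).toMonoidHom.comp (freeLast (le_of_hom φ))) (by
      intro σ σ' hσ
      obtain ⟨ψ, hψ⟩ := QuotientGroup.leftRel_apply.mp hσ
      obtain rfl : σ' = σ * shift 0 (n'.strands - n.strands) n'.strands (by omega) ψ := by
        rw [hψ, mul_inv_cancel_left]
      ext1 i
      have := hc.action n.strands n'.strands (le_of_hom φ) 1 ψ (FreeGroup.of i)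
      rw [juxt, map_one, map_one, mul_one] at this
      simp only [MonoidHom.comp_apply, MulEquiv.coe_toMonoidHom, map_mul, MulAut.mul_apply]
      rw [← this]
      rfl) φ.1

theorem freeMap_hom (hc : Coherent a ς) {n n' : ℕ} (h : n ≤ n') (σ : BraidGroup n')
    (g : FreeGroup (Fin n)) : freeMap hc (hom h σ) g = a n' σ (freeLast h g) := rfl

theorem freeMap_id (hc : Coherent a ς) (n : UBeta) : freeMap hc (𝟙 n) = MonoidHom.id _ := by
  ext1 i
  change freeMap hc (hom le_rfl 1) _ = _
  rw [freeMap_hom, freeLast_self, map_one]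
  rfl

theorem freeMap_comp (hc : Coherent a ς) {n n' n'' : UBeta} (φ : n ⟶ n') (χ : n' ⟶ n'') :
    freeMap hc (φ ≫ χ) = (freeMap hc χ).comp (freeMap hc φ) := by
  obtain ⟨n⟩ := n
  obtain ⟨n'⟩ := n'
  obtain ⟨n''⟩ := n''
  obtain ⟨h, f, rfl⟩ := hom_surj φ
  obtain ⟨h', f', rfl⟩ := hom_surj χ
  ext1 i
  rw [MonoidHom.comp_apply, hom_comp_hom, freeMap_hom, freeMap_hom, freeMap_hom, map_mul,
    MulAut.mul_apply, hc.action n' n'' h' f 1, freeLast_freeLast, juxt, map_one, one_mul]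

theorem braid_comp_tensorLeft_map (hc : Coherent a ς) {n n' : UBeta} (φ : n ⟶ n')
    (g : FreeGroup (Fin n.strands)) :
    braid (ς n.strands g) ≫ (tensorLeft 1).map φ =
      (tensorLeft 1).map φ ≫ braid (ς n'.strands (freeMap hc φ g)) := by
  obtain ⟨n⟩ := n
  obtain ⟨n'⟩ := n'
  obtain ⟨h, f, rfl⟩ := hom_surj φ
  have h1 := hc.stability n n' h g
  have h2 := hc.compat n' f (freeLast h g)
  rw [juxt, map_one, one_mul] at h2
  rw [freeMap_hom]
  have e : (tensorLeft 1).map (hom h f) = (tensorLeft 1).map (hom h 1) ≫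
      braid (shift 1 n' (1 + n') le_rfl f) := tensorLeft_map_braid 1 h f
  refine (congrArg (braid (ς n g) ≫ ·) e).trans ?_
  refine (Category.assoc _ _ _).symm.trans ?_
  refine (congrArg (· ≫ braid (shift 1 n' (1 + n') le_rfl f)) h1).trans ?_
  refine (Category.assoc _ _ _).trans ?_
  refine Eq.trans ?_ (congrArg (· ≫ braid (ς n' (a n' f (freeLast h g)))) e).symm
  refine Eq.trans ?_ (Category.assoc _ _ _).symm
  refine congrArg ((tensorLeft 1).map (hom h 1) ≫ ·) ?_
  refine (braid_mul _ _).symm.trans (Eq.trans ?_ (braid_mul _ _))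
  rw [h2]

variable {K : Type u} [CommRing K]

/-- The action of `F_n` on `F(1 + n)` through `ς_n : F_n → B_{1+n}`. -/
def freeRep (ς : ∀ n : ℕ, FreeGroup (Fin n) →* BraidGroup (1 + n)) (F : UBeta ⥤ ModuleCat.{u} K)
    (n : ℕ) : Representation K (FreeGroup (Fin n)) (F.obj ⟨1 + n⟩) where
  toFun g := (F.map (braid (ς n g))).hom
  map_one' := by
    rw [map_one, braid_one, F.map_id]
    rfl
  map_mul' g g' := by
    rw [map_mul, braid_mul, F.map_comp]
    rfl

theorem freeRep_apply (F : UBeta ⥤ ModuleCat.{u} K) (n : ℕ) (g : FreeGroup (Fin n))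
    (v : F.obj ⟨1 + n⟩) : freeRep ς F n g v = (F.map (braid (ς n g))).hom v := rfl

theorem freeRep_tensorLeft_map (hc : Coherent a ς) (F : UBeta ⥤ ModuleCat.{u} K) {n n' : UBeta}
    (φ : n ⟶ n') (g : FreeGroup (Fin n.strands)) (v : F.obj ⟨1 + n.strands⟩) :
    (F.map ((tensorLeft 1).map φ)).hom (freeRep ς F n.strands g v) =
      freeRep ς F n'.strands (freeMap hc φ g) ((F.map ((tensorLeft 1).map φ)).hom v) := by
  have h := congrArg (fun χ => (F.map χ).hom v) (braid_comp_tensorLeft_map hc φ g)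
  have h1 := congrArg (fun χ => χ.hom v)
    (F.map_comp (braid (ς n.strands g)) ((tensorLeft 1).map φ))
  have h2 := congrArg (fun χ => χ.hom v)
    (F.map_comp ((tensorLeft 1).map φ) (braid (ς n'.strands (freeMap hc φ g))))
  exact h1.symm.trans (h.trans h2)

/-- The value `LM(F)` of the Long-Moody functor on a functor `F`: it maps `n` to the tensor product
over `K[F_n]` of the augmentation ideal of `K[F_n]` with `F(1 + n)`, and `φ = [n' - n, σ]` to
`i ⊗ v ↦ a_{n'}(σ)((ι_{F_{n'-n}} * id_{F_n})(i)) ⊗ F(id_1 ♮ φ)(v)`. -/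
def longMoodyObj (hc : Coherent a ς) (F : UBeta ⥤ ModuleCat.{u} K) : UBeta ⥤ ModuleCat.{u} K where
  obj n := ModuleCat.of K (AugTensor (freeRep ς F n.strands))
  map φ := ModuleCat.ofHom (AugTensor.map (freeMap hc φ) (F.map ((tensorLeft 1).map φ)).hom
    (freeRep_tensorLeft_map hc F φ))
  map_id n := by
    refine ModuleCat.hom_ext (AugTensor.hom_ext fun i m => ?_)
    change AugTensor.tmul _ (augMap (freeMap hc (𝟙 n)) i)
      ((F.map ((tensorLeft 1).map (𝟙 n))).hom m) = AugTensor.tmul _ i m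
    rw [freeMap_id, augMap_id, (tensorLeft 1).map_id]
    refine congrArg (AugTensor.tmul _ i) ?_
    exact congrArg (fun χ => χ.hom m) (F.map_id _)
  map_comp φ χ := by
    refine ModuleCat.hom_ext (AugTensor.hom_ext fun i m => ?_)
    change AugTensor.tmul _ (augMap (freeMap hc (φ ≫ χ)) i)
      ((F.map ((tensorLeft 1).map (φ ≫ χ))).hom m) =
        AugTensor.tmul _ (augMap (freeMap hc χ) (augMap (freeMap hc φ) i))
          ((F.map ((tensorLeft 1).map φ) ≫ F.map ((tensorLeft 1).map χ)).hom m)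
    rw [freeMap_comp, augMap_comp, (tensorLeft 1).map_comp, F.map_comp]

variable (K) in
/-- The Long-Moody functor `LM_{a,ς}` associated with coherent families `a` and `ς`; it maps a
natural transformation `η` to `i ⊗ v ↦ i ⊗ η_{1+n}(v)`. -/
def longMoody (hc : Coherent a ς) :
    (UBeta ⥤ ModuleCat.{u} K) ⥤ (UBeta ⥤ ModuleCat.{u} K) where
  obj F := longMoodyObj hc F
  map {F F'} η :=
    { app n := ModuleCat.ofHom (AugTensor.map (ρ := freeRep ς F n.strands)
        (ρ' := freeRep ς F' n.strands) (MonoidHom.id _) (η.app ⟨1 + n.strands⟩).hom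
        fun g v => congrArg (fun χ => χ.hom v) (η.naturality (braid (ς n.strands g))))
      naturality n n' φ := by
        refine ModuleCat.hom_ext (AugTensor.hom_ext fun i m => ?_)
        have := congrArg (fun χ => χ.hom m) (η.naturality ((tensorLeft 1).map φ))
        change AugTensor.tmul _ (augMap (MonoidHom.id _) (augMap (freeMap hc φ) i)) _ =
          AugTensor.tmul _ (augMap (freeMap hc φ) (augMap (MonoidHom.id _) i)) _
        rw [augMap_id, augMap_id]
        exact congrArg _ this }
  map_id F := by
    ext1
    funext n
    refine ModuleCat.hom_ext (AugTensor.hom_ext fun i m => ?_)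
    change AugTensor.tmul _ (augMap (MonoidHom.id _) i) m = AugTensor.tmul _ i m
    rw [augMap_id]
    rfl
  map_comp η θ := by
    ext1
    funext n
    refine ModuleCat.hom_ext (AugTensor.hom_ext fun i m => ?_)
    change AugTensor.tmul _ (augMap (MonoidHom.id _) i) _ =
      AugTensor.tmul _ (augMap (MonoidHom.id _) (augMap (MonoidHom.id _) i)) _
    rw [augMap_id]
    rfl

end LongMoodyFunctor

/-! ## Strong and very strong polynomial functors on `𝔘β` -/

section Polynomial

variable {A : Type v} [Category.{w} A] [Abelian A]

/-- The translation functor `τ_x`, precomposition by `x ♮ -`. -/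
def translation (A : Type v) [Category.{w} A] (x : ℕ) : (UBeta ⥤ A) ⥤ (UBeta ⥤ A) :=
  (Functor.whiskeringLeft UBeta UBeta A).obj (tensorLeft x)

/-- The natural transformation `i_x : F ⟶ τ_x(F)` induced by `ι_x : 0 ⟶ x`; its component at `n` is
`F(ι_x ♮ id_n)`. -/
def toTranslation (x : ℕ) (F : UBeta ⥤ A) : F ⟶ (translation A x).obj F where
  app n := F.map ((unitTensor x).app n)
  naturality n n' φ := by
    refine (F.map_comp _ _).symm.trans (Eq.trans ?_ (F.map_comp _ _))
    exact congrArg F.map ((unitTensor x).naturality φ)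

/-- The evanescence functor `κ_x`, on objects. -/
noncomputable def evanescence (x : ℕ) (F : UBeta ⥤ A) : UBeta ⥤ A := kernel (toTranslation x F)

/-- The difference functor `δ_x`, on objects. -/
noncomputable def difference (x : ℕ) (F : UBeta ⥤ A) : UBeta ⥤ A := cokernel (toTranslation x F)

/-- `IsStrongPolynomialLT m F`: `F` is strong polynomial of degree less than `m`, that is of degree
less than or equal to `m - 1`. Only the zero functors are so for `m = 0`. -/
def IsStrongPolynomialLT : ℕ → (UBeta ⥤ A) → Prop
  | 0, F => IsZero F
  | m + 1, F => ∀ x : ℕ, IsStrongPolynomialLT m (difference x F)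

/-- `F` is strong polynomial of degree less than or equal to `n`. -/
def IsStrongPolynomial (n : ℕ) (F : UBeta ⥤ A) : Prop := IsStrongPolynomialLT (n + 1) F

/-- `IsVeryStrongPolynomialLT m F`: `F` is very strong polynomial of degree less than `m`, that is
of degree less than or equal to `m - 1`. Only the zero functors are so for `m = 0`. -/
def IsVeryStrongPolynomialLT : ℕ → (UBeta ⥤ A) → Prop
  | 0, F => IsZero F
  | m + 1, F => IsStrongPolynomialLT (m + 1) F ∧
      ∀ x : ℕ, IsZero (evanescence x F) ∧ IsVeryStrongPolynomialLT m (difference x F)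

/-- `F` is very strong polynomial of degree less than or equal to `n`. -/
def IsVeryStrongPolynomial (n : ℕ) (F : UBeta ⥤ A) : Prop := IsVeryStrongPolynomialLT (n + 1) F

/-- `F` is very strong polynomial of degree (equal to) `d`: the natural number `d` is the smallest
one for which `F` is very strong polynomial of degree less than or equal to `d`. -/
def HasVeryStrongDegree (F : UBeta ⥤ A) (d : ℕ) : Prop :=
  IsLeast {n : ℕ | IsVeryStrongPolynomial n F} d

end Polynomial

end LongMoody

/-! ### Very strong polynomial functors: closure under summands of finite sums. -/

namespace LongMoody

/-! The augmentation ideal of a free group is a free right module on the elements g_j - 1, so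
LM(F)(n) is a sum of n copies of F(1+n). This makes LM exact (`longMoody_map_exact`). It also splits
the translate: in τ_x(LM(F))(n) the first x generators contribute x copies of F(1+x+n), and the last
n generators contribute LM(τ_x(F))(n), after F(1+x+n) is identified with F(x+1+n) by the braiding.
Coherence makes the second piece a subfunctor, and reliability does the same for the first, because
it says that id_x ♮ φ fixes the first x generators (`Reliable.freeMap_tensorLeft`). Hence τ_x(LM(F))
is LM(τ_x(F)) plus x copies of τ_x(τ_1(F)) (`head_add_tail`).

The morphism i_x of LM(F) is LM(i_x) followed by the inclusion of LM(τ_x(F))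
(`toTranslation_longMoody`). So κ_x(LM(F)) vanishes when κ_x(F) does, and δ_x(LM(F)) is LM(δ_x(F))
plus x copies of τ_x(τ_1(F)).

Upper bound: translations preserve the degree, since they are exact and commute with κ_x and δ_x up
to the braiding. The copies of τ_x(τ_1(F)) thus have degree at most d, LM(δ_x(F)) is handled by
induction, and LM(F) has degree at most d+1.

Lower bound: for x = 1, τ_1(τ_1(F)) is a retract of δ_1(LM(F)). A bound on LM(F) therefore gives a
bound smaller by one on τ_1(τ_1(F)), which descends to F because F embeds into its translates
(`IsVeryStrongPolynomialLT.of_translation`). -/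

theorem toTranslation_naturality {A : Type v} [Category.{w} A] (x : ℕ) {F G : UBeta ⥤ A}
    (η : F ⟶ G) :
    toTranslation x F ≫ (translation A x).map η = η ≫ toTranslation x G := by
  ext n
  exact η.naturality _

section Closure

variable {A : Type v} [Category.{w} A] [Abelian A]

/-- The inclusion `κ_x(F) ⟶ F`. -/
noncomputable def evanescenceι (x : ℕ) (F : UBeta ⥤ A) : evanescence x F ⟶ F :=
  kernel.ι (toTranslation x F)

instance (x : ℕ) (F : UBeta ⥤ A) : Mono (evanescenceι x F) :=
  inferInstanceAs (Mono (kernel.ι (toTranslation x F)))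

/-- The projection `τ_x(F) ⟶ δ_x(F)`. -/
noncomputable def differenceπ (x : ℕ) (F : UBeta ⥤ A) : (translation A x).obj F ⟶ difference x F :=
  cokernel.π (toTranslation x F)

instance (x : ℕ) (F : UBeta ⥤ A) : Epi (differenceπ x F) :=
  inferInstanceAs (Epi (cokernel.π (toTranslation x F)))

theorem toTranslation_comp_differenceπ (x : ℕ) (F : UBeta ⥤ A) :
    toTranslation x F ≫ differenceπ x F = 0 := cokernel.condition _

/-- Morphisms out of `δ_x(F)`. -/
noncomputable def differenceDesc (x : ℕ) {F G : UBeta ⥤ A} (η : (translation A x).obj F ⟶ G)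
    (h : toTranslation x F ≫ η = 0) : difference x F ⟶ G := cokernel.desc _ η h

theorem differenceπ_desc (x : ℕ) {F G : UBeta ⥤ A} (η : (translation A x).obj F ⟶ G)
    (h : toTranslation x F ≫ η = 0) : differenceπ x F ≫ differenceDesc x η h = η :=
  cokernel.π_desc _ _ _

/-- The evanescence functor `κ_x`, on morphisms. -/
noncomputable def evanescenceMap (x : ℕ) {F G : UBeta ⥤ A} (η : F ⟶ G) :
    evanescence x F ⟶ evanescence x G :=
  kernel.map _ _ η ((translation A x).map η) (toTranslation_naturality x η)

theorem evanescenceMap_ι (x : ℕ) {F G : UBeta ⥤ A} (η : F ⟶ G) :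
    evanescenceMap x η ≫ evanescenceι x G = evanescenceι x F ≫ η :=
  kernel.lift_ι _ _ _

/-- The difference functor `δ_x`, on morphisms. -/
noncomputable def differenceMap (x : ℕ) {F G : UBeta ⥤ A} (η : F ⟶ G) :
    difference x F ⟶ difference x G :=
  differenceDesc x ((translation A x).map η ≫ differenceπ x G) (by
    rw [← Category.assoc, toTranslation_naturality, Category.assoc,
      toTranslation_comp_differenceπ, comp_zero])

theorem π_differenceMap (x : ℕ) {F G : UBeta ⥤ A} (η : F ⟶ G) :
    differenceπ x F ≫ differenceMap x η = (translation A x).map η ≫ differenceπ x G :=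
  differenceπ_desc _ _ _

variable {ι : Type*} [Fintype ι] {X : ι → UBeta ⥤ A} {Y : UBeta ⥤ A}

/-- A relation ∑ p_i s_i = id exhibits Y as a direct summand of the sum of the X_i without forming
biproducts. It passes to κ_x because it can be tested after the monomorphism into Y. -/
theorem sum_evanescenceMap (x : ℕ) (p : ∀ i, Y ⟶ X i) (s : ∀ i, X i ⟶ Y)
    (h : ∑ i, p i ≫ s i = 𝟙 Y) :
    ∑ i, evanescenceMap x (p i) ≫ evanescenceMap x (s i) = 𝟙 (evanescence x Y) := by
  refine (cancel_mono (evanescenceι x Y)).mp ?_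
  have e : ∀ i, (evanescenceMap x (p i) ≫ evanescenceMap x (s i)) ≫ evanescenceι x Y =
      evanescenceι x Y ≫ p i ≫ s i := fun i => by
    rw [Category.assoc, evanescenceMap_ι, ← Category.assoc, evanescenceMap_ι, Category.assoc]
  rw [Preadditive.sum_comp, Finset.sum_congr rfl fun i _ => e i, ← Preadditive.comp_sum, h,
    Category.comp_id, Category.id_comp]

/-- Dually, the relation is tested before δ_x, on τ_x(Y), where it holds because precomposition is
additive. -/
theorem sum_differenceMap (x : ℕ) (p : ∀ i, Y ⟶ X i) (s : ∀ i, X i ⟶ Y)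
    (h : ∑ i, p i ≫ s i = 𝟙 Y) :
    ∑ i, differenceMap x (p i) ≫ differenceMap x (s i) = 𝟙 (difference x Y) := by
  refine (cancel_epi (differenceπ x Y)).mp ?_
  have e : ∀ i, differenceπ x Y ≫ differenceMap x (p i) ≫ differenceMap x (s i) =
      (translation A x).map (p i ≫ s i) ≫ differenceπ x Y := fun i => by
    rw [← Category.assoc, π_differenceMap, Category.assoc, π_differenceMap, ← Category.assoc,
      Functor.map_comp]
  have e' : ∑ i, (translation A x).map (p i ≫ s i) = 𝟙 _ := by
    rw [← (translation A x).map_id, ← h]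
    exact (Functor.map_sum
      ((Functor.whiskeringLeft UBeta UBeta A).obj (UBeta.tensorLeft x)) _ _).symm
  rw [Preadditive.comp_sum, Finset.sum_congr rfl fun i _ => e i, ← Preadditive.sum_comp, e',
    Category.comp_id, Category.id_comp]

theorem isZero_of_sum {C : Type*} [Category* C] [Preadditive C] {X : ι → C} {Y : C}
    (p : ∀ i, Y ⟶ X i) (s : ∀ i, X i ⟶ Y) (h : ∑ i, p i ≫ s i = 𝟙 Y)
    (hX : ∀ i, IsZero (X i)) : IsZero Y := by
  rw [IsZero.iff_id_eq_zero, ← h]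
  exact Finset.sum_eq_zero fun i _ => by rw [(hX i).eq_of_tgt (p i) 0, zero_comp]

theorem IsVeryStrongPolynomialLT.isStrongPolynomialLT {m : ℕ} {F : UBeta ⥤ A}
    (h : IsVeryStrongPolynomialLT m F) : IsStrongPolynomialLT m F := by
  cases m with
  | zero => exact h
  | succ m => exact h.1

/-- The strong polynomiality clause of the definition is redundant: it only concerns the
differences, which are very strong polynomial already. Inductions can ignore it. -/
theorem isVeryStrongPolynomialLT_succ {m : ℕ} {F : UBeta ⥤ A} :
    IsVeryStrongPolynomialLT (m + 1) F ↔
      ∀ x : ℕ, IsZero (evanescence x F) ∧ IsVeryStrongPolynomialLT m (difference x F) :=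
  ⟨fun h => h.2, fun h => ⟨fun x => (h x).2.isStrongPolynomialLT, h⟩⟩

/-- The class of very strong polynomial functors of degree less than `m` is closed under direct
summands of finite direct sums. -/
theorem IsVeryStrongPolynomialLT.of_sum {m : ℕ} (p : ∀ i, Y ⟶ X i) (s : ∀ i, X i ⟶ Y)
    (h : ∑ i, p i ≫ s i = 𝟙 Y) (hX : ∀ i, IsVeryStrongPolynomialLT m (X i)) :
    IsVeryStrongPolynomialLT m Y := by
  induction m generalizing X Y with
  | zero => exact isZero_of_sum p s h hX
  | succ m ih =>
    exact isVeryStrongPolynomialLT_succ.mpr fun x =>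
      ⟨isZero_of_sum _ _ (sum_evanescenceMap x p s h) fun i => (hX i).2 x |>.1,
        ih _ _ (sum_differenceMap x p s h) fun i => (hX i).2 x |>.2⟩

theorem IsVeryStrongPolynomialLT.of_retract {m : ℕ} {F G : UBeta ⥤ A} (p : F ⟶ G) (s : G ⟶ F)
    (h : p ≫ s = 𝟙 F) (hG : IsVeryStrongPolynomialLT m G) : IsVeryStrongPolynomialLT m F :=
  .of_sum (ι := Unit) (X := fun _ => G) (fun _ => p) (fun _ => s) (by simpa using h) fun _ => hG

theorem IsVeryStrongPolynomialLT.of_iso {m : ℕ} {F G : UBeta ⥤ A} (e : F ≅ G)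
    (hG : IsVeryStrongPolynomialLT m G) : IsVeryStrongPolynomialLT m F :=
  hG.of_retract e.hom e.inv e.hom_inv_id

theorem isZero_evanescence_of_isZero (x : ℕ) {F : UBeta ⥤ A} (hF : IsZero F) :
    IsZero (evanescence x F) := hF.of_mono (evanescenceι x F)

theorem isZero_translation (x : ℕ) {F : UBeta ⥤ A} (hF : IsZero F) :
    IsZero ((translation A x).obj F) :=
  Functor.map_isZero ((Functor.whiskeringLeft UBeta UBeta A).obj (UBeta.tensorLeft x)) hF

theorem isZero_difference_of_isZero (x : ℕ) {F : UBeta ⥤ A} (hF : IsZero F) :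
    IsZero (difference x F) := (isZero_translation x hF).of_epi (differenceπ x F)

theorem IsVeryStrongPolynomialLT.of_isZero {m : ℕ} {F : UBeta ⥤ A} (hF : IsZero F) :
    IsVeryStrongPolynomialLT m F := by
  induction m generalizing F with
  | zero => exact hF
  | succ m ih =>
    exact isVeryStrongPolynomialLT_succ.mpr fun x =>
      ⟨isZero_evanescence_of_isZero x hF, ih (isZero_difference_of_isZero x hF)⟩

end Closure

end LongMoody

/-! ### Further relations of the braiding: first-variable naturality and the other hexagon. -/

namespace LongMoody

namespace BraidGroup

/-- Two adjacent columns move two neighbouring strands across p others, and the crossing of these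
two strands slides through. -/
theorem column_column_sigma (N j p : ℕ) (hN : j + p + 1 < N) :
    column N j p * column N (j + 1) p * sigma N j =
      sigma N (j + p) * (column N j p * column N (j + 1) p) := by
  induction p with
  | zero => simp [column]
  | succ p ih =>
    have hc := column_comm_sigma N (j + p + 1) j p (by omega)
    have hb := sigma_braid N (j + p) (by omega)
    have ih := ih (by omega)
    simp only [column]
    rw [show j + 1 + p = j + p + 1 by omega, show j + (p + 1) = j + p + 1 by omega]
    -- The top crossing of the second column commutes with the lower part of the first. Moving it
    -- left makes room for the induction hypothesis, and then for the braid relation on the three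
    -- leading crossings.
    have e : sigma N (j + p) * column N j p * (sigma N (j + p + 1) * column N (j + 1) p) =
        sigma N (j + p) * sigma N (j + p + 1) * (column N j p * column N (j + 1) p) := by
      rw [mul_assoc, ← mul_assoc (column N j p), ← hc]
      simp only [mul_assoc]
    rw [e, mul_assoc _ _ (sigma N j), ih, ← mul_assoc, hb]
    simp only [mul_assoc]

/-- A crossing not involving the last column commutes with it, which leaves the induction
hypothesis. Otherwise it involves exactly the last two columns and slides through them by
`column_column_sigma`. -/
theorem rows_mul_sigma_left (N p m i : ℕ) (hi : i + 1 < m) (hN : m + p ≤ N) :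
    rows N p m * sigma N i = sigma N (p + i) * rows N p m := by
  induction m with
  | zero => omega
  | succ m ih =>
    rcases Nat.lt_or_ge (i + 1) m with h | h
    · simp only [rows]
      rw [mul_assoc, ← sigma_comm_column N i m p (by omega), ← mul_assoc, ih h (by omega),
        mul_assoc]
    · obtain rfl : m = i + 1 := by omega
      simp only [rows]
      rw [mul_assoc (rows N p i), mul_assoc, column_column_sigma N i p (by omega), ← mul_assoc,
        ← rows_comm_sigma N p i (i + p) le_rfl, add_comm p i]
      simp only [mul_assoc]

/-- Naturality of the braiding in its first variable, in a braid group on possibly more strands. -/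
theorem rows_mul_shift_left (N p m : ℕ) (h : m + p ≤ N) (ψ : BraidGroup m) :
    rows N p m * shift 0 m N (by omega) ψ = shift p m N (by omega) ψ * rows N p m := by
  have : (MulAut.conj (rows N p m)).toMonoidHom.comp (shift 0 m N (by omega)) =
      shift p m N (by omega) :=
    hom_ext fun i hi => by
      simp only [MonoidHom.comp_apply, shift_sigma _ _ _ _ _ hi, MulEquiv.coe_toMonoidHom,
        MulAut.conj_apply]
      rw [zero_add, rows_mul_sigma_left N p m i hi h, mul_inv_cancel_right]
  have h2 := DFunLike.congr_fun this ψ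
  simp only [MonoidHom.comp_apply, MulEquiv.coe_toMonoidHom, MulAut.conj_apply] at h2
  rwa [mul_inv_eq_iff_eq_mul] at h2

/-- The other hexagon relation, in a braid group on possibly more strands. -/
theorem rows_add_right (N n p y x : ℕ) (h : y + n ≤ N) (hx : x + p ≤ n) :
    rows N p (y + x) = rows N p y * shift y n N h (rows n p x) := by
  induction x with
  | zero => simp [rows]
  | succ x ih =>
    rw [← add_assoc]
    simp only [rows, map_mul]
    rw [ih (by omega), shift_column y n N h x p (by omega), mul_assoc]

theorem shift_zero_rows (n N p x : ℕ) (h : 0 + n ≤ N) (hx : x + p ≤ n) :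
    shift 0 n N h (rows n p x) = rows N p x := by
  have := rows_add_right N n p 0 x h hx
  simpa [rows] using this.symm

theorem shift_rows_one (k n N x : ℕ) (h : k + n ≤ N) (hx : 1 + x ≤ n) :
    shift k n N h (rows n x 1) = column N k x := by
  simp only [rows, one_mul]
  exact shift_column k n N h 0 x (by omega)

theorem rows_zero_left (N x : ℕ) : rows N 0 x = 1 := by
  induction x with
  | zero => rfl
  | succ x ih => simp [rows, ih, column]

theorem rows_eq_shift_braiding (N p x : ℕ) (h : x + p ≤ N) :
    rows N p x = shift 0 (x + p) N (by omega) (braiding x p) := (shift_zero_braiding x p N (by omega)).symm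

instance : Subsingleton (BraidGroup 1) := by
  have : (MonoidHom.id (BraidGroup 1)) = 1 := hom_ext fun i hi => by omega
  exact ⟨fun a b => (DFunLike.congr_fun this a).trans (DFunLike.congr_fun this b).symm⟩

end BraidGroup

/-! ### The braiding as a natural isomorphism in 𝔘β. -/

namespace UBeta

open BraidGroup

theorem hom_inj {n n' : ℕ} {h h' : n ≤ n'} {f f' : BraidGroup n'} (e : hom h f = hom h' f') :
    f⁻¹ * f' ∈ leftBraids n n' := QuotientGroup.eq.mp (congrArg Subtype.val e)

theorem tensorLeft_map_hom_rows (x : ℕ) {n n' : ℕ} (h : n ≤ n') (f : BraidGroup n') (p : ℕ)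
    (hp : n' - n = p) : (tensorLeft x).map (hom h f) = hom (n := x + n) (n' := x + n') (by omega)
      (shift x n' (x + n') le_rfl f * (rows (x + n') p x)⁻¹) := by
  subst hp
  rw [tensorLeft_map_hom, shift_zero_braiding]

/-- The braiding `b_{y,x} ♮ id_n : y ♮ (x ♮ n) ⟶ x ♮ (y ♮ n)`. -/
def swap (y x : ℕ) : tensorLeft x ⋙ tensorLeft y ≅ tensorLeft y ⋙ tensorLeft x :=
  -- The source y + (x + n) and the target x + (y + n) are equal, but not definitionally. The braid
  -- therefore enters through `hom`, with no strand added, rather than through `braid`.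
  NatIso.ofComponents (fun n =>
    { hom := hom (n := y + (x + n.strands)) (n' := x + (y + n.strands)) (by omega) (rows _ x y)
      inv := hom (n := x + (y + n.strands)) (n' := y + (x + n.strands)) (by omega) (rows _ x y)⁻¹
      hom_inv_id := by
        refine (hom_comp_hom _ _ _ _).trans ?_
        rw [shift_congr (Nat.sub_eq_zero_of_le (by omega)), shift_zero_rows _ _ _ _ _ (by omega),
          inv_mul_cancel]
        rfl
      inv_hom_id := by
        refine (hom_comp_hom _ _ _ _).trans ?_
        rw [shift_congr (Nat.sub_eq_zero_of_le (by omega)), map_inv,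
          shift_zero_rows _ _ _ _ _ (by omega), mul_inv_cancel]
        rfl }) fun {n n'} φ => by
    obtain ⟨n⟩ := n
    obtain ⟨n'⟩ := n'
    obtain ⟨h, f, rfl⟩ := hom_surj φ
    dsimp only at h
    obtain ⟨p, rfl⟩ := Nat.exists_eq_add_of_le h
    -- By the hexagon `rows_add_right`, y ♮ (x ♮ -) has the same braid representative as (y + x) ♮
    -- -; it remains to compare the two orders.
    have key : ∀ x y : ℕ, (tensorLeft y).map ((tensorLeft x).map (hom h f)) =
        hom (n := y + (x + n)) (n' := y + (x + (n + p))) (by omega)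
          (shift (y + x) (n + p) _ (by omega) f * (rows _ p (y + x))⁻¹) := fun x y => by
      refine (congrArg (tensorLeft y).map (tensorLeft_map_hom_rows x h f p (by omega))).trans ?_
      refine (tensorLeft_map_hom_rows y _ _ p (by omega)).trans ?_
      rw [map_mul, map_inv, shift_shift, mul_assoc, ← mul_inv_rev,
        ← rows_add_right _ _ p y x _ (by omega)]
    change (tensorLeft y).map ((tensorLeft x).map (hom h f)) ≫
        hom _ (rows (x + (y + (n + p))) x y) =
      hom _ (rows (x + (y + n)) x y) ≫ (tensorLeft x).map ((tensorLeft y).map (hom h f))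
    refine (congrArg (· ≫ _) (key x y)).trans (Eq.trans ?_ (congrArg (_ ≫ ·) (key y x)).symm)
    refine (hom_comp_hom (n := y + (x + n)) (n' := y + (x + (n + p))) (n'' := x + (y + (n + p)))
      _ _ _ _).trans (Eq.trans ?_ (hom_comp_hom (n := y + (x + n)) (n' := x + (y + n))
        (n'' := x + (y + (n + p))) _ _ _ _).symm)
    congr 1
    rw [shift_congr (Nat.sub_eq_zero_of_le (by omega)), map_mul, shift_shift, map_inv,
      shift_zero_rows _ _ _ _ _ (by omega)]
    rw [shift_congr (show x + (y + (n + p)) - (x + (y + n)) = p by omega)]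
    -- The braid b_{y,x} slides through the braiding with the p new strands by naturality in the
    -- first variable. It commutes with f because the two lie on disjoint sets of strands.
    have e1 := rows_mul_shift_left (x + (y + (n + p))) p (y + x) (by omega) (braiding y x)
    rw [shift_zero_braiding] at e1
    have e2 : shift p (x + (y + n)) (x + (y + (n + p))) (by omega) (rows _ x y) =
        shift p (y + x) (x + (y + (n + p))) (by omega) (braiding y x) := by
      rw [rows_eq_shift_braiding _ x y (by omega), shift_shift, shift_congr (add_zero p)]
    have e3 := shift_comm 0 (y + x) (y + x) (n + p) (x + (y + (n + p))) (by omega) (by omega)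
      (by omega) (braiding y x) f
    rw [shift_zero_braiding] at e3
    rw [e2, ← mul_assoc, shift_congr (zero_add (y + x)), e3,
      shift_congr (add_comm x y), mul_assoc, mul_assoc,
      show rows (x + (y + (n + p))) p (x + y) = _ from congrArg _ (add_comm x y)]
    congr 1
    rw [eq_inv_mul_iff_mul_eq, ← mul_assoc, e1, mul_inv_cancel_right]

/-- By definition id_y ♮ (ι_x ♮ id_n) is represented by the inverse of b_{y,x} ♮ id_n, which the
swap cancels. -/
theorem tensorLeft_map_unitTensor (y x : ℕ) (n : UBeta) :
    (tensorLeft y).map ((unitTensor x).app n) ≫ (swap y x).hom.app n =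
      (unitTensor x).app ((tensorLeft y).obj n) := by
  obtain ⟨n⟩ := n
  refine (congrArg (· ≫ _) (tensorLeft_map_hom_rows y _ 1 x (by omega))).trans ?_
  refine (hom_comp_hom _ _ _ _).trans ?_
  rw [map_one, one_mul, shift_congr (Nat.sub_eq_zero_of_le (by omega)), map_inv,
    shift_zero_rows _ _ _ _ _ (by omega), mul_inv_cancel]
  rfl

end UBeta

end LongMoody

/-! ### Translation functors and the degree. -/

namespace LongMoody

/-- The translation functors commute with each other, up to the braiding. -/
def translationSwap {A : Type v} [Category.{w} A] (y x : ℕ) (F : UBeta ⥤ A) :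
    (translation A x).obj ((translation A y).obj F) ≅
      (translation A y).obj ((translation A x).obj F) :=
  Functor.isoWhiskerRight (UBeta.swap y x) F

/-- Since τ_y is exact, this identification of morphisms is what makes κ_x and δ_x commute with τ_y.
-/
theorem toTranslation_swap {A : Type v} [Category.{w} A] (y x : ℕ) (F : UBeta ⥤ A) :
    toTranslation x ((translation A y).obj F) ≫ (translationSwap y x F).hom =
      (translation A y).map (toTranslation x F) := by
  ext n
  exact (F.map_comp _ _).symm.trans (congrArg F.map (UBeta.tensorLeft_map_unitTensor y x n))

section Translation

variable {A : Type v} [Category.{w} A] [Abelian A]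

instance (y : ℕ) : (translation A y).Additive :=
  inferInstanceAs ((Functor.whiskeringLeft UBeta UBeta A).obj (UBeta.tensorLeft y)).Additive

instance (y : ℕ) : PreservesFiniteLimits (translation A y) :=
  ⟨fun J _ _ => inferInstanceAs (PreservesLimitsOfShape J
    ((Functor.whiskeringLeft UBeta UBeta A).obj (UBeta.tensorLeft y)))⟩

instance (y : ℕ) : PreservesFiniteColimits (translation A y) :=
  ⟨fun J _ _ => inferInstanceAs (PreservesColimitsOfShape J
    ((Functor.whiskeringLeft UBeta UBeta A).obj (UBeta.tensorLeft y)))⟩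

/-- The difference functors commute with the translation functors. -/
noncomputable def differenceTranslation (y x : ℕ) (F : UBeta ⥤ A) :
    difference x ((translation A y).obj F) ≅ (translation A y).obj (difference x F) :=
  cokernel.mapIso _ ((translation A y).map (toTranslation x F)) (Iso.refl _)
    (translationSwap y x F) ((toTranslation_swap y x F).trans (Category.id_comp _).symm) ≪≫
    (PreservesCokernel.iso (translation A y) (toTranslation x F)).symm

/-- The evanescence functors commute with the translation functors. -/
noncomputable def evanescenceTranslation (y x : ℕ) (F : UBeta ⥤ A) :
    evanescence x ((translation A y).obj F) ≅ (translation A y).obj (evanescence x F) :=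
  kernel.mapIso _ ((translation A y).map (toTranslation x F)) (Iso.refl _)
    (translationSwap y x F) ((toTranslation_swap y x F).trans (Category.id_comp _).symm) ≪≫
    (PreservesKernel.iso (translation A y) (toTranslation x F)).symm

theorem IsVeryStrongPolynomialLT.translation_obj {m : ℕ} (y : ℕ) {F : UBeta ⥤ A}
    (hF : IsVeryStrongPolynomialLT m F) :
    IsVeryStrongPolynomialLT m ((translation A y).obj F) := by
  induction m generalizing F with
  | zero => exact isZero_translation y hF
  | succ m ih =>
    exact isVeryStrongPolynomialLT_succ.mpr fun x =>
      ⟨(isZero_translation y (hF.2 x).1).of_iso (evanescenceTranslation y x F),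
        (ih (hF.2 x).2).of_iso (differenceTranslation y x F)⟩

theorem mono_toTranslation {x : ℕ} {F : UBeta ⥤ A} (h : IsZero (evanescence x F)) :
    Mono (toTranslation x F) :=
  Preadditive.mono_of_kernel_zero (h.eq_of_src (kernel.ι (toTranslation x F)) 0)

/-- The a priori bound M supplies the vanishing of the evanescences of F and of its iterated
differences. Then F embeds into τ_y(F), which settles m = 0, and the differences commute with τ_y.
-/
theorem IsVeryStrongPolynomialLT.of_translation {m M : ℕ} (y : ℕ) {F : UBeta ⥤ A}
    (hF : IsVeryStrongPolynomialLT M F)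
    (h : IsVeryStrongPolynomialLT m ((translation A y).obj F)) :
    IsVeryStrongPolynomialLT m F := by
  induction m generalizing F M with
  | zero =>
    cases M with
    | zero => exact hF
    | succ M =>
      have := mono_toTranslation (hF.2 y).1
      exact IsZero.of_mono (toTranslation y F) h
  | succ m ih =>
    cases M with
    | zero => exact .of_isZero hF
    | succ M =>
      exact isVeryStrongPolynomialLT_succ.mpr fun x =>
        ⟨(hF.2 x).1, ih (hF.2 x).2 ((h.2 x).2.of_iso (differenceTranslation y x F).symm)⟩

end Translation

/-! ### Consequences of coherence and reliability. -/

section Families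

open BraidGroup UBeta

variable {a : ∀ n : ℕ, BraidGroup n →* MulAut (FreeGroup (Fin n))}
  {ς : ∀ n : ℕ, FreeGroup (Fin n) →* BraidGroup (1 + n)}

/-- The stability condition for the addition of one strand holds in the braid group. -/
theorem Coherent.stability_one (hc : Coherent a ς) (n : ℕ) (g : FreeGroup (Fin n)) :
    rows (1 + (n + 1)) 1 1 * ς (n + 1) (freeLast n.le_succ g) =
      shift 1 (1 + n) (1 + (n + 1)) (by omega) (ς n g) * rows (1 + (n + 1)) 1 1 := by
  have h := hc.stability n (n + 1) n.le_succ g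
  have e1 := tensorLeft_map_hom_rows 1 n.le_succ 1 1 (by omega)
  have h2 : hom _ _ = hom _ _ :=
    (((hom_comp_hom _ _ _ _).symm.trans (congrArg (braid (ς n g) ≫ ·) e1).symm).trans h).trans
      ((congrArg (· ≫ braid (ς (n + 1) (freeLast n.le_succ g))) e1).trans (hom_comp_braid _ _ _))
  -- Equality in 𝔘β is only equality up to a braid on the added strands. With a single added strand
  -- that braid is trivial, so the identity holds between braids.
  obtain ⟨ψ, hψ⟩ := hom_inj h2
  have : Subsingleton (BraidGroup (1 + n.succ - (1 + n))) := by
    rw [show 1 + n.succ - (1 + n) = 1 by omega]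
    infer_instance
  rw [Subsingleton.elim ψ 1, map_one, eq_comm, inv_mul_eq_one,
    shift_congr (show 1 + n.succ - (1 + n) = 1 by omega)] at hψ
  rw [map_one, one_mul] at hψ
  rw [eq_mul_inv_iff_mul_eq, mul_assoc, inv_mul_eq_iff_eq_mul] at hψ
  exact hψ.symm

/-- For several added strands, the stability condition alone leaves an unknown braid on these
strands. Adding them one at a time removes this ambiguity. -/
theorem Coherent.stability_rows (hc : Coherent a ς) (n x : ℕ) (g : FreeGroup (Fin n)) :
    rows (1 + (n + x)) x 1 * ς (n + x) (freeLast (n.le_add_right x) g) =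
      shift x (1 + n) (1 + (n + x)) (by omega) (ς n g) * rows (1 + (n + x)) x 1 := by
  induction x with
  | zero =>
    rw [rows_zero_left, one_mul, mul_one, freeLast_self]
    exact (shift_self _ _ _).symm
  | succ x ih =>
    have h1 := hc.stability_one (n + x) (freeLast (n.le_add_right x) g)
    rw [freeLast_freeLast] at h1
    have h2 := congrArg (shift 1 (1 + (n + x)) (1 + (n + (x + 1))) (by omega)) ih
    rw [map_mul, map_mul, shift_rows_one _ _ _ _ _ (by omega), shift_shift,
      shift_congr (add_comm 1 x)] at h2
    -- One strand crosses x + 1 others by first crossing one, which is the one-strand case, and then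
    -- the remaining x, which is the induction hypothesis shifted by one strand.
    have h3 : rows (1 + (n + (x + 1))) (x + 1) 1 =
        column (1 + (n + (x + 1))) 1 x * rows (1 + (n + (x + 1))) 1 1 := by
      simp only [rows, one_mul]
      rw [add_comm x 1, column_add]
    rw [h3, mul_assoc]
    refine (congrArg _ h1).trans ?_
    exact (mul_assoc _ _ _).symm.trans ((congrArg (· * _) h2).trans (mul_assoc _ _ _))

/-- The numbers of strands are left free up to propositional equality, since `swap` relates 1 + (x +
n) to x + (1 + n). -/
theorem Coherent.stability_shift (hc : Coherent a ς) {n n' x N : ℕ} (h : n ≤ n') (e : n' = n + x)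
    (e' : N = 1 + n') (g : FreeGroup (Fin n)) :
    rows N x 1 * shift 0 (1 + n') N (by omega) (ς n' (freeLast h g)) =
      shift x (1 + n) N (by omega) (ς n g) * rows N x 1 := by
  subst e'
  subst e
  rw [shift_self]
  exact hc.stability_rows n x g

theorem freeMap_unitTensor (hc : Coherent a ς) (x n : ℕ) (g : FreeGroup (Fin n)) :
    freeMap hc ((unitTensor x).app ⟨n⟩) g = freeLast (Nat.le_add_left n x) g := by
  refine (freeMap_hom hc _ _ _).trans ?_
  rw [map_one]
  rfl

/-- The stability condition, with respect to the braiding. -/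
theorem Coherent.braid_comp_swap (hc : Coherent a ς) (x n : ℕ) (g : FreeGroup (Fin n)) :
    braid (ς (x + n) (freeMap hc ((unitTensor x).app ⟨n⟩) g)) ≫ (swap 1 x).hom.app ⟨n⟩ =
      (swap 1 x).hom.app ⟨n⟩ ≫ (tensorLeft x).map (braid (ς n g)) := by
  have e : (tensorLeft x).map (braid (ς n g)) =
      braid (shift x (1 + n) (x + (1 + n)) le_rfl (ς n g)) := by
    refine (tensorLeft_map_hom_rows x le_rfl (ς n g) 0 (by omega)).trans ?_
    rw [rows_zero_left, inv_one, mul_one]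
    rfl
  refine Eq.trans ?_ (congrArg (_ ≫ ·) e).symm
  refine (hom_comp_hom (n := 1 + (x + n)) (n' := 1 + (x + n)) (n'' := x + (1 + n))
    _ _ _ _).trans (Eq.trans ?_ (hom_comp_braid (n := 1 + (x + n)) (n' := x + (1 + n)) _ _ _).symm)
  refine congrArg (hom _) ?_
  rw [freeMap_unitTensor, shift_congr (show x + (1 + n) - (1 + (x + n)) = 0 by omega)]
  exact hc.stability_shift (Nat.le_add_left n x) (add_comm x n)
    (show x + (1 + n) = 1 + (x + n) by omega) g

theorem freeLast_of {n n' : ℕ} (h : n ≤ n') (i : Fin n) :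
    freeLast h (FreeGroup.of i) = FreeGroup.of ⟨n' - n + i, by omega⟩ := FreeGroup.map.of

theorem freeFirst_of {n n' : ℕ} (h : n ≤ n') (i : Fin n) :
    freeFirst h (FreeGroup.of i) = FreeGroup.of ⟨i, by omega⟩ := FreeGroup.map.of

/-- A braid on the last strands fixes the first generators. -/
theorem Reliable.shift_apply (hr : Reliable a) {k n N : ℕ} (e : N = k + n) (σ : BraidGroup n)
    (i : Fin N) (hi : (i : ℕ) < k) :
    a N (shift k n N (by omega) σ) (FreeGroup.of i) = FreeGroup.of i := by
  have h := hr.stabilizer n N (by omega) σ (FreeGroup.of ⟨i, by omega⟩)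
  rwa [freeFirst_of, juxt, map_one, one_mul, shift_congr (show N - n = k by omega)] at h

/-- A braid on the first strands fixes the last generators. -/
theorem Coherent.shift_zero_apply (hc : Coherent a ς) {k N : ℕ} (h : 0 + k ≤ N)
    (σ : BraidGroup k) (i : Fin N) (hi : k ≤ i) :
    a N (shift 0 k N h σ) (FreeGroup.of i) = FreeGroup.of i := by
  obtain ⟨n, rfl⟩ := Nat.exists_eq_add_of_le' (show k ≤ N by omega)
  -- The number n + k - n is only propositionally equal to k; here `shift 0` acts as a cast.
  have h := hc.action n (n + k) (by omega) 1 (shift 0 k _ (by omega) σ)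
    (FreeGroup.of ⟨i - k, by omega⟩)
  rw [freeLast_of, juxt, map_one, map_one, mul_one, MulAut.one_apply, freeLast_of, shift_shift,
    shift_congr (add_zero 0)] at h
  have e : (⟨n + k - n + (i - k), by omega⟩ : Fin (n + k)) = i := Fin.ext (by simp only; omega)
  rw [e] at h
  exact h.symm

/-- The action on the last generators of a braid on the last strands. -/
theorem Coherent.shift_apply (hc : Coherent a ς) {k n N : ℕ} (e : N = k + n) (σ : BraidGroup n)
    (g : FreeGroup (Fin n)) :
    a N (shift k n N (by omega) σ) (freeLast (by omega) g) = freeLast (by omega) (a n σ g) := by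
  rw [hc.action n N (by omega) σ 1, juxt, map_one, one_mul, shift_congr (show N - n = k by omega)]

/-- The braiding b_{1,p} is a single column. The first reliability condition, inverted, says how it
moves generator 0, and coherence transports this j strands to the right. -/
theorem Reliable.column_apply (hc : Coherent a ς) (hr : Reliable a) (N j p : ℕ) (h : j + p < N) :
    a N (column N j p) (FreeGroup.of ⟨j, by omega⟩) = FreeGroup.of ⟨j + p, h⟩ := by
  obtain ⟨n, rfl⟩ := Nat.exists_eq_add_of_le (show j + p + 1 ≤ N by omega)
  have h0 := hr.braiding n (p + n) (by omega) (FreeGroup.of 0)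
  rw [freeFirst_of, freeFirst_of, freeLast_of, juxt, map_one, mul_one, map_inv,
    shift_zero_braiding, map_inv, MulAut.inv_apply, MulEquiv.symm_apply_eq] at h0
  have h1 := congrArg (freeLast (show 1 + (p + n) ≤ j + p + 1 + n by omega)) h0
  rw [← hc.shift_apply (k := j) (by omega), freeLast_of, freeLast_of,
    shift_rows_one _ _ _ _ _ (by omega)] at h1
  simp only [Nat.add_sub_cancel, Fin.coe_ofNat_eq_mod, Nat.zero_mod, add_zero] at h1
  have e : j + p + 1 + n - (1 + (p + n)) = j := by omega
  have e' : j + (1 + (p + n) - (1 + n)) = j + p := by omega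
  simp only [e, e'] at h1
  exact h1.symm

/-- A reliable action of the braiding on the first generators. -/
theorem Reliable.rows_apply (hc : Coherent a ς) (hr : Reliable a) (N p x k : ℕ) (hk : k < x)
    (h : p + x ≤ N) :
    a N (rows N p x) (FreeGroup.of ⟨k, by omega⟩) = FreeGroup.of ⟨k + p, by omega⟩ := by
  induction x with
  | zero => omega
  | succ x ih =>
    simp only [rows]
    rw [map_mul, MulAut.mul_apply]
    rcases Nat.lt_or_ge k x with hkx | hkx
    -- The last column involves only strands of index at least x, so it fixes the generators before
    -- x.
    · have e : column N x p = shift x (N - x) N (by omega) (column (N - x) 0 p) := by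
        rw [shift_column _ _ _ _ _ _ (by omega), add_zero]
      rw [e, hr.shift_apply (by omega) _ _ hkx, ih hkx (by omega)]
    -- The last column sends generator k to k + p. The other columns live on the first k + p
    -- strands, so they fix it.
    · obtain rfl : k = x := by omega
      rw [hr.column_apply hc N k p (by omega), rows_eq_shift_braiding N p k (by omega),
        hc.shift_zero_apply _ _ _ (by simp)]

/-- The morphisms `id_x ♮ φ` act trivially on the first `x` generators. -/
theorem Reliable.freeMap_tensorLeft (hc : Coherent a ς) (hr : Reliable a) (x : ℕ) {n n' : UBeta}
    (φ : n ⟶ n') (k : Fin x) :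
    freeMap hc ((tensorLeft x).map φ) (FreeGroup.of (Fin.castAdd n.strands k)) =
      FreeGroup.of (Fin.castAdd n'.strands k) := by
  obtain ⟨n⟩ := n
  obtain ⟨n'⟩ := n'
  obtain ⟨h, f, rfl⟩ := hom_surj φ
  dsimp only at h
  obtain ⟨p, rfl⟩ := Nat.exists_eq_add_of_le h
  have e := tensorLeft_map_hom_rows x h f p (by omega)
  refine (congrArg (fun χ => freeMap hc χ (FreeGroup.of (Fin.castAdd n k))) e).trans ?_
  refine (freeMap_hom hc _ _ _).trans ?_
  rw [freeLast_of, map_mul, MulAut.mul_apply, map_inv]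
  -- Stabilization moves generator k to k + p, and the inverse of b_{x,p} brings it back to k. What
  -- remains is id_x ♮ f, which fixes the first x generators.
  have e2 : (⟨x + (n + p) - (x + n) + (Fin.castAdd n k : ℕ), by simp; omega⟩ : Fin (x + (n + p))) =
      ⟨k + p, by omega⟩ := by
    ext
    simp
    omega
  rw [e2, ← hr.rows_apply hc (x + (n + p)) p x k k.2 (by omega), MulAut.inv_apply_self]
  exact hr.shift_apply rfl f _ k.2

end Families

end LongMoody

/-! ### The augmentation ideal of a free group, and Fox derivatives. -/

namespace LongMoody

noncomputable section FreeAugmentation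

open scoped TensorProduct

variable {K : Type u} [CommRing K] {G : Type*} [Group G] {H : Type*} [Group H]
  {M : Type*} [AddCommGroup M] [Module K M] {N : Type*} [AddCommGroup N] [Module K N]

variable (K) in
/-- The element `g - 1` of the augmentation ideal. -/
def augSub (g : G) : AugIdeal K G :=
  ⟨MonoidAlgebra.of K G g - 1, by rw [mem_augIdeal, map_sub, MonoidAlgebra.lift_of]; simp⟩

theorem coe_augSub (g : G) : (augSub K g).1 = MonoidAlgebra.of K G g - 1 := rfl

theorem augMap_augSub (φ : G →* H) (g : G) : augMap φ (augSub K g) = augSub K (φ g) := by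
  refine Subtype.ext ?_
  rw [coe_augMap, coe_augSub, coe_augSub, map_sub, map_one]
  simp

/-- The Leibniz rule of Fox calculus. -/
theorem augSub_mul (g h : G) : augSub K (g * h) =
    augMul (augSub K g) (MonoidAlgebra.of K G h) + augSub K h := by
  refine Subtype.ext ?_
  change MonoidAlgebra.of K G (g * h) - 1 = (MonoidAlgebra.of K G g - 1) * MonoidAlgebra.of K G h +
    (MonoidAlgebra.of K G h - 1)
  rw [map_mul]
  noncomm_ring

theorem augSub_one : augSub K (1 : G) = 0 :=
  Subtype.ext (by rw [coe_augSub, map_one, sub_self]; rfl)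

theorem span_augSub : Submodule.span K (Set.range (augSub K (G := G))) = ⊤ := by
  have key : ∀ x : MonoidAlgebra K G, ∃ i ∈ Submodule.span K (Set.range (augSub K (G := G))),
      i.1 = x - MonoidAlgebra.lift K K G 1 x • 1 := by
    intro x
    induction x using MonoidAlgebra.induction_on with
    | of g => exact ⟨augSub K g, Submodule.subset_span ⟨g, rfl⟩, by simp [coe_augSub]⟩
    | add x y hx hy =>
      obtain ⟨i, hi, hix⟩ := hx
      obtain ⟨j, hj, hjy⟩ := hy
      refine ⟨i + j, add_mem hi hj, ?_⟩
      change i.1 + j.1 = _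
      rw [hix, hjy, map_add, add_smul]
      abel
    | smul c x hx =>
      obtain ⟨i, hi, hix⟩ := hx
      refine ⟨c • i, Submodule.smul_mem _ c hi, ?_⟩
      change c • i.1 = _
      rw [hix, map_smul, smul_sub, smul_assoc]
  refine eq_top_iff.mpr fun i _ => ?_
  obtain ⟨j, hj, hji⟩ := key i.1
  rw [mem_augIdeal.mp i.2, zero_smul, sub_zero] at hji
  rwa [← show j = i from Subtype.ext hji]

namespace AugTensor

theorem tmul_add_left (ρ : Representation K G M) (i j : AugIdeal K G) (m : M) :
    tmul ρ (i + j) m = tmul ρ i m + tmul ρ j m :=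
  congrArg Submodule.Quotient.mk (TensorProduct.add_tmul i j m)

theorem tmul_smul_left (ρ : Representation K G M) (c : K) (i : AugIdeal K G) (m : M) :
    tmul ρ (c • i) m = c • tmul ρ i m := rfl

theorem tmul_zero_left (ρ : Representation K G M) (m : M) : tmul ρ 0 m = 0 :=
  congrArg Submodule.Quotient.mk (TensorProduct.zero_tmul _ m)

theorem tmul_augMul (ρ : Representation K G M) (i : AugIdeal K G) (r : MonoidAlgebra K G) (m : M) :
    tmul ρ (augMul i r) m = tmul ρ i (ρ.asAlgebraHom r m) :=
  (Submodule.Quotient.eq _).mpr (Submodule.subset_span ⟨i, r, m, rfl⟩)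

theorem tmul_augSub_mul (ρ : Representation K G M) (g h : G) (m : M) :
    tmul ρ (augSub K (g * h)) m = tmul ρ (augSub K g) (ρ h m) + tmul ρ (augSub K h) m := by
  rw [augSub_mul, tmul_add_left, tmul_augMul, Representation.asAlgebraHom_of]

variable {α : Type*}

/-- The map `m ↦ (g_j - 1) ⊗ m`. -/
def gen (ρ : Representation K (FreeGroup α) M) (j : α) : M →ₗ[K] AugTensor ρ :=
  (augRel ρ).mkQ ∘ₗ TensorProduct.mk K _ M (augSub K (FreeGroup.of j))

theorem gen_apply (ρ : Representation K (FreeGroup α) M) (j : α) (m : M) :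
    gen ρ j m = tmul ρ (augSub K (FreeGroup.of j)) m := rfl

/-- The elements g - 1 span the ideal, and the Leibniz rule reduces each of them, by induction on
words, to the generators. -/
theorem hom_ext_gen {P : Type*} [AddCommGroup P] [Module K P]
    {ρ : Representation K (FreeGroup α) M} {f f' : AugTensor ρ →ₗ[K] P}
    (h : ∀ j, f ∘ₗ gen ρ j = f' ∘ₗ gen ρ j) : f = f' := by
  have key : ∀ g m, f (tmul ρ (augSub K g) m) = f' (tmul ρ (augSub K g) m) := by
    intro g
    induction g using FreeGroup.induction_on with
    | C1 => intro m; rw [augSub_one, tmul_zero_left, map_zero, map_zero]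
    | of j => exact fun m => LinearMap.congr_fun (h j) m
    | inv_of j ih =>
      intro m
      -- The vector is chosen so that the action of g_j cancels, which gives (g_j⁻¹ - 1) ⊗ m = -(g_j
      -- - 1) ⊗ g_j⁻¹ m.
      have h1 := tmul_augSub_mul ρ (FreeGroup.of j)⁻¹ (FreeGroup.of j) (ρ (FreeGroup.of j)⁻¹ m)
      rw [inv_mul_cancel, augSub_one, tmul_zero_left, ← Module.End.mul_apply, ← map_mul,
        mul_inv_cancel, map_one, Module.End.one_apply] at h1
      rw [eq_neg_of_add_eq_zero_left h1.symm, map_neg, map_neg, ih]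
    | mul g g' ih ih' => intro m; rw [tmul_augSub_mul, map_add, map_add, ih, ih']
  refine hom_ext fun i m => ?_
  have hi : i ∈ Submodule.span K (Set.range (augSub K (G := FreeGroup α))) := by
    rw [span_augSub]
    trivial
  induction hi using Submodule.span_induction with
  | mem i hi =>
    obtain ⟨g, rfl⟩ := hi
    exact key g m
  | zero => rw [tmul_zero_left, map_zero, map_zero]
  | add i j _ _ hi hj => rw [tmul_add_left, map_add, map_add, hi, hj]
  | smul c i _ hi => rw [tmul_smul_left, map_smul, map_smul, hi]

theorem map_gen {ρ : Representation K (FreeGroup α) M} {ρ' : Representation K H N}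
    (φ : FreeGroup α →* H) (f : M →ₗ[K] N) (hf : ∀ g m, f (ρ g m) = ρ' (φ g) (f m)) (j : α)
    (m : M) : map φ f hf (gen ρ j m) = tmul ρ' (augSub K (φ (FreeGroup.of j))) (f m) := by
  rw [gen_apply, map_tmul, augMap_augSub]

variable [DecidableEq α]

/-- The automorphism `(m, n) ↦ (g_j m, e_j m + n)` of `M × M^α`. -/
def foxEquiv (ρ : Representation K (FreeGroup α) M) (j : α) :
    (M × (α → M)) ≃ₗ[K] (M × (α → M)) where
  toFun v := (ρ (FreeGroup.of j) v.1, Pi.single j v.1 + v.2)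
  invFun v := (ρ (FreeGroup.of j)⁻¹ v.1, v.2 - Pi.single j (ρ (FreeGroup.of j)⁻¹ v.1))
  map_add' v w := by
    ext1
    · simp
    · simp only [Prod.fst_add, Prod.snd_add, Pi.single_add]
      abel
  map_smul' c v := by
    ext1
    · simp
    · simp only [Prod.smul_fst, Prod.smul_snd, Pi.single_smul, RingHom.id_apply, smul_add]
  left_inv v := by
    ext1
    · simp
    · simp
  right_inv v := by
    ext1
    · simp
    · simp

/-- The extension of a representation of a free group which encodes Fox derivatives. -/
def foxRep (ρ : Representation K (FreeGroup α) M) :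
    Representation K (FreeGroup α) (M × (α → M)) :=
  (LinearEquiv.automorphismGroup.toLinearMapMonoidHom (R := K) (M := M × (α → M))).comp
    (FreeGroup.lift (foxEquiv ρ))

theorem foxRep_of (ρ : Representation K (FreeGroup α) M) (j : α) (v : M × (α → M)) :
    foxRep ρ (FreeGroup.of j) v = (ρ (FreeGroup.of j) v.1, Pi.single j v.1 + v.2) := by
  have : FreeGroup.lift (foxEquiv ρ) (FreeGroup.of j) = foxEquiv ρ j := FreeGroup.lift_apply_of
  exact congrArg (fun e : (M × (α → M)) ≃ₗ[K] (M × (α → M)) => e v) this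

theorem foxRep_inv_of (ρ : Representation K (FreeGroup α) M) (j : α) (v : M × (α → M)) :
    foxRep ρ (FreeGroup.of j)⁻¹ v =
      (ρ (FreeGroup.of j)⁻¹ v.1, v.2 - Pi.single j (ρ (FreeGroup.of j)⁻¹ v.1)) := by
  have : FreeGroup.lift (foxEquiv ρ) (FreeGroup.of j)⁻¹ = (foxEquiv ρ j)⁻¹ := by
    rw [map_inv, FreeGroup.lift_apply_of]
  exact congrArg (fun e : (M × (α → M)) ≃ₗ[K] (M × (α → M)) => e v) this

/-- With `foxRep_zero`, this makes `foxRep` an extension of ρ by the trivial representation M^α. The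
Fox derivatives are its cocycle. -/
theorem foxRep_fst (ρ : Representation K (FreeGroup α) M) (g : FreeGroup α) (v : M × (α → M)) :
    (foxRep ρ g v).1 = ρ g v.1 := by
  induction g using FreeGroup.induction_on generalizing v with
  | C1 => rw [map_one, map_one]; rfl
  | of j => rw [foxRep_of]
  | inv_of j => rw [foxRep_inv_of]
  | mul g h ihg ihh => rw [map_mul, map_mul, Module.End.mul_apply, ihg, ihh, Module.End.mul_apply]

theorem foxRep_zero (ρ : Representation K (FreeGroup α) M) (g : FreeGroup α) (n : α → M) :
    foxRep ρ g (0, n) = (0, n) := by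
  induction g using FreeGroup.induction_on with
  | C1 => rw [map_one]; rfl
  | of j => rw [foxRep_of]; simp
  | inv_of j => rw [foxRep_inv_of]; simp
  | mul g h ihg ihh => rw [map_mul, Module.End.mul_apply, ihh, ihg]

theorem foxRep_asAlgebraHom_fst (ρ : Representation K (FreeGroup α) M)
    (r : MonoidAlgebra K (FreeGroup α)) (v : M × (α → M)) :
    ((foxRep ρ).asAlgebraHom r v).1 = ρ.asAlgebraHom r v.1 := by
  induction r using MonoidAlgebra.induction_on with
  | of g => rw [Representation.asAlgebraHom_of, Representation.asAlgebraHom_of, foxRep_fst]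
  | add x y hx hy => simp only [map_add, LinearMap.add_apply, Prod.fst_add, hx, hy]
  | smul c x hx => simp only [map_smul, LinearMap.smul_apply, Prod.smul_fst, hx]

/-- The group ring acts on the trivial part through the augmentation, so the augmentation ideal
kills it. Hence `coords` is well defined over the group ring. -/
theorem foxRep_asAlgebraHom_zero (ρ : Representation K (FreeGroup α) M)
    (r : MonoidAlgebra K (FreeGroup α)) (n : α → M) :
    (foxRep ρ).asAlgebraHom r (0, n) = (0, MonoidAlgebra.lift K K (FreeGroup α) 1 r • n) := by
  induction r using MonoidAlgebra.induction_on with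
  | of g => rw [Representation.asAlgebraHom_of, foxRep_zero]; simp
  | add x y hx hy => simp only [map_add, LinearMap.add_apply, hx, hy, add_smul, Prod.mk_add_mk,
      add_zero]
  | smul c x hx => simp only [map_smul, LinearMap.smul_apply, hx, Prod.smul_mk, smul_zero,
      smul_assoc]

/-- The coordinates of an element of the tensor product with the augmentation ideal, with respect
to the basis formed by the elements `g_j - 1`. -/
def coords (ρ : Representation K (FreeGroup α) M) : AugTensor ρ →ₗ[K] (α → M) :=
  (augRel ρ).liftQ (TensorProduct.lift (LinearMap.mk₂ K
    (fun (i : AugIdeal K (FreeGroup α)) (m : M) => ((foxRep ρ).asAlgebraHom i.1 (m, 0)).2)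
    (fun i j m => by
      change ((foxRep ρ).asAlgebraHom (i.1 + j.1) (m, 0)).2 = _
      rw [map_add]
      rfl)
    (fun c i m => by
      change ((foxRep ρ).asAlgebraHom (c • i.1) (m, 0)).2 = _
      rw [map_smul]
      rfl)
    (fun i m m' => by
      rw [← Prod.snd_add, ← map_add, Prod.mk_add_mk, add_zero])
    (fun c i m => by
      rw [← Prod.smul_snd, ← map_smul, Prod.smul_mk, smul_zero]))) (by
    refine Submodule.span_le.mpr ?_
    rintro _ ⟨i, r, m, rfl⟩
    refine LinearMap.mem_ker.mpr ?_
    rw [map_sub, TensorProduct.lift.tmul, TensorProduct.lift.tmul, sub_eq_zero,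
      LinearMap.mk₂_apply, LinearMap.mk₂_apply]
    change ((foxRep ρ).asAlgebraHom (i.1 * r) (m, 0)).2 = _
    -- The second summand lies in the trivial part, which i annihilates.
    have e : (foxRep ρ).asAlgebraHom r (m, 0) = (ρ.asAlgebraHom r m, 0) +
        (0, ((foxRep ρ).asAlgebraHom r (m, 0)).2) := by
      ext1
      · simp [foxRep_asAlgebraHom_fst]
      · simp
    rw [map_mul, Module.End.mul_apply, e, map_add, foxRep_asAlgebraHom_zero, mem_augIdeal.mp i.2]
    simp)

theorem coords_tmul (ρ : Representation K (FreeGroup α) M) (i : AugIdeal K (FreeGroup α)) (m : M) :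
    coords ρ (tmul ρ i m) = ((foxRep ρ).asAlgebraHom i.1 (m, 0)).2 := rfl

/-- The coordinate of index `j` with respect to the basis formed by the elements `g_j - 1`. -/
def coord (ρ : Representation K (FreeGroup α) M) (j : α) : AugTensor ρ →ₗ[K] M :=
  LinearMap.proj j ∘ₗ coords ρ

theorem coord_gen (ρ : Representation K (FreeGroup α) M) (j k : α) (m : M) :
    coord ρ j (gen ρ k m) = if j = k then m else 0 := by
  change coords ρ (tmul ρ _ m) j = _
  rw [coords_tmul, coe_augSub, map_sub, map_one, Representation.asAlgebraHom_of,
    LinearMap.sub_apply, Prod.snd_sub, foxRep_of]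
  simp [Pi.single_apply]

theorem coord_gen_self (ρ : Representation K (FreeGroup α) M) (j : α) (m : M) :
    coord ρ j (gen ρ j m) = m := by rw [coord_gen, if_pos rfl]

theorem coord_gen_of_ne (ρ : Representation K (FreeGroup α) M) {j k : α} (h : j ≠ k) (m : M) :
    coord ρ j (gen ρ k m) = 0 := by rw [coord_gen, if_neg h]

/-- Together with `coord_gen` this identifies the tensor product with M^α: the ideal is free on the
elements g_j - 1. It suffices to check it on the generators. -/
theorem sum_gen_coord [Fintype α] (ρ : Representation K (FreeGroup α) M) (y : AugTensor ρ) :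
    ∑ j, gen ρ j (coord ρ j y) = y := by
  have : ∑ j, gen ρ j ∘ₗ coord ρ j = LinearMap.id := by
    refine hom_ext_gen fun k => LinearMap.ext fun m => ?_
    rw [LinearMap.comp_apply, LinearMap.sum_apply, Finset.sum_eq_single k]
    · rw [LinearMap.comp_apply, coord_gen_self]
      rfl
    · intro j _ hj
      rw [LinearMap.comp_apply, coord_gen_of_ne ρ hj, map_zero]
    · exact fun h => absurd (Finset.mem_univ k) h
  simpa using LinearMap.congr_fun this y

theorem ext_coord [Fintype α] {ρ : Representation K (FreeGroup α) M} {y y' : AugTensor ρ}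
    (h : ∀ j, coord ρ j y = coord ρ j y') : y = y' := by
  rw [← sum_gen_coord ρ y, ← sum_gen_coord ρ y']
  exact Finset.sum_congr rfl fun j _ => by rw [h]

/-- Naturality of the coordinates in M; through it, additivity and exactness of LM are checked one
coordinate at a time. -/
theorem coord_map_id {ρ : Representation K (FreeGroup α) M} {ρ' : Representation K (FreeGroup α) N}
    (f : M →ₗ[K] N) (hf : ∀ g m, f (ρ g m) = ρ' (MonoidHom.id _ g) (f m)) (j : α)
    (y : AugTensor ρ) : coord ρ' j (map (MonoidHom.id _) f hf y) = f (coord ρ j y) := by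
  have : coord ρ' j ∘ₗ map (MonoidHom.id _) f hf = f ∘ₗ coord ρ j := by
    refine hom_ext_gen fun k => LinearMap.ext fun m => ?_
    change coord ρ' j (map _ f hf (gen ρ k m)) = f (coord ρ j (gen ρ k m))
    rw [map_gen]
    change coord ρ' j (gen ρ' k (f m)) = _
    rw [coord_gen, coord_gen]
    split_ifs <;> simp
  exact LinearMap.congr_fun this y

end AugTensor

end FreeAugmentation

end LongMoody

/-! ### Exactness of the Long-Moody functor and the splitting of its translates. -/

namespace LongMoody

noncomputable section Decomposition

open BraidGroup UBeta

variable {a : ∀ n : ℕ, BraidGroup n →* MulAut (FreeGroup (Fin n))}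
  {ς : ∀ n : ℕ, FreeGroup (Fin n) →* BraidGroup (1 + n)} {K : Type u} [CommRing K]

theorem exact_of_exact_app {C D : Type*} [Category* C] [Category* D] [Abelian D]
    (S : ShortComplex (C ⥤ D)) (h : ∀ c, (S.map ((evaluation C D).obj c)).Exact) : S.Exact := by
  rw [ShortComplex.exact_iff_isZero_homology, Functor.isZero_iff]
  intro c
  exact ((ShortComplex.exact_iff_isZero_homology _).mp (h c)).of_iso
    (S.mapHomologyIso ((evaluation C D).obj c)).symm

theorem longMoody_map_app (hc : Coherent a ς) {F F' : UBeta ⥤ ModuleCat.{u} K} (η : F ⟶ F')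
    (n : ℕ) (i : AugIdeal K (FreeGroup (Fin n))) (v : F.obj ⟨1 + n⟩) :
    (((longMoody K hc).map η).app ⟨n⟩).hom (AugTensor.tmul (freeRep ς F n) i v) =
      AugTensor.tmul (freeRep ς F' n) i ((η.app ⟨1 + n⟩).hom v) := by
  change AugTensor.tmul _ (augMap (MonoidHom.id _) i) _ = _
  rw [augMap_id]
  rfl

theorem app_freeRep {F F' : UBeta ⥤ ModuleCat.{u} K} (η : F ⟶ F') (n : ℕ) (g : FreeGroup (Fin n))
    (v : F.obj ⟨1 + n⟩) : (η.app ⟨1 + n⟩).hom (freeRep ς F n g v) =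
      freeRep ς F' n (MonoidHom.id _ g) ((η.app ⟨1 + n⟩).hom v) :=
  congrArg (fun χ => χ.hom v) (η.naturality (braid (ς n g)))

theorem coord_longMoody_map (hc : Coherent a ς) {F F' : UBeta ⥤ ModuleCat.{u} K} (η : F ⟶ F')
    (n : ℕ) (j : Fin n) (y : AugTensor (freeRep ς F n)) :
    AugTensor.coord (freeRep ς F' n) j ((((longMoody K hc).map η).app ⟨n⟩).hom y) =
      (η.app ⟨1 + n⟩).hom (AugTensor.coord (freeRep ς F n) j y) :=
  AugTensor.coord_map_id (ρ := freeRep ς F n) (ρ' := freeRep ς F' n) (η.app ⟨1 + n⟩).hom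
    (app_freeRep η n) j y

instance (hc : Coherent a ς) : (longMoody K hc).Additive where
  map_add {F F' η θ} := by
    ext1
    funext n
    refine ModuleCat.hom_ext (LinearMap.ext fun (y : AugTensor (freeRep ς F n.strands)) => ?_)
    refine AugTensor.ext_coord (ρ := freeRep ς F' n.strands) fun k => ?_
    refine (coord_longMoody_map hc _ _ _ _).trans ?_
    refine Eq.trans ?_ (map_add (AugTensor.coord (freeRep ς F' n.strands) k)
      ((((longMoody K hc).map η).app n).hom y) ((((longMoody K hc).map θ).app n).hom y)).symm
    exact (congrArg₂ (· + ·) (coord_longMoody_map hc η _ _ _)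
      (coord_longMoody_map hc θ _ _ _)).symm

/-- In coordinates LM sends F to n copies of F(1+n) at n, so a cycle is lifted coordinate by
coordinate. -/
theorem longMoody_map_exact (hc : Coherent a ς) (S : ShortComplex (UBeta ⥤ ModuleCat.{u} K))
    (hS : S.Exact) : (S.map (longMoody K hc)).Exact := by
  refine exact_of_exact_app _ fun n => ?_
  rw [ShortComplex.moduleCat_exact_iff]
  intro (y : AugTensor (freeRep ς S.X₂ n.strands)) hy
  have h := (ShortComplex.moduleCat_exact_iff _).mp
    (hS.map ((evaluation UBeta (ModuleCat.{u} K)).obj ⟨1 + n.strands⟩))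
  have hy' : ∀ j, ∃ v : S.X₁.obj ⟨1 + n.strands⟩, (S.f.app ⟨1 + n.strands⟩).hom v =
      AugTensor.coord (freeRep ς S.X₂ n.strands) j y := fun j => by
    refine h (AugTensor.coord (freeRep ς S.X₂ n.strands) j y) ?_
    refine (coord_longMoody_map hc S.g n.strands j y).symm.trans ?_
    exact (congrArg (AugTensor.coord (freeRep ς S.X₃ n.strands) j) hy).trans (map_zero _)
  choose v hv using hy'
  refine ⟨∑ j, AugTensor.gen (freeRep ς S.X₁ n.strands) j (v j), ?_⟩
  refine Eq.trans ?_ (AugTensor.sum_gen_coord (freeRep ς S.X₂ n.strands) y)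
  refine (map_sum (((longMoody K hc).map S.f).app n).hom _ _).trans ?_
  refine Finset.sum_congr rfl fun j _ => ?_
  refine (longMoody_map_app hc S.f n.strands _ _).trans ?_
  rw [hv]
  rfl

theorem longMoody_preserves (hc : Coherent a ς) :
    PreservesFiniteLimits (longMoody K hc) ∧ PreservesFiniteColimits (longMoody K hc) := by
  have h := (Functor.exact_tfae (longMoody K hc)).out 1 3
  exact h.mp (longMoody_map_exact hc)

instance (hc : Coherent a ς) : PreservesFiniteColimits (longMoody K hc) :=
  (longMoody_preserves hc).2

instance (hc : Coherent a ς) : PreservesFiniteLimits (longMoody K hc) :=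
  (longMoody_preserves hc).1

theorem Coherent.swap_inv_comp_braid (hc : Coherent a ς) (x n : ℕ) (g : FreeGroup (Fin n)) :
    (swap 1 x).inv.app ⟨n⟩ ≫ braid (ς (x + n) (freeMap hc ((unitTensor x).app ⟨n⟩) g)) =
      (tensorLeft x).map (braid (ς n g)) ≫ (swap 1 x).inv.app ⟨n⟩ := by
  have h := congrArg (fun χ => (swap 1 x).inv.app ⟨n⟩ ≫ χ ≫ (swap 1 x).inv.app ⟨n⟩)
    (hc.braid_comp_swap x n g)
  have e1 : (swap 1 x).hom.app ⟨n⟩ ≫ (swap 1 x).inv.app ⟨n⟩ = 𝟙 _ := (swap 1 x).hom_inv_id_app _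
  have e2 : (swap 1 x).inv.app ⟨n⟩ ≫ (swap 1 x).hom.app ⟨n⟩ = 𝟙 _ := (swap 1 x).inv_hom_id_app _
  have l : (swap 1 x).inv.app ⟨n⟩ ≫
      (braid (ς (x + n) (freeMap hc ((unitTensor x).app ⟨n⟩) g)) ≫ (swap 1 x).hom.app ⟨n⟩) ≫
        (swap 1 x).inv.app ⟨n⟩ = (swap 1 x).inv.app ⟨n⟩ ≫
          braid (ς (x + n) (freeMap hc ((unitTensor x).app ⟨n⟩) g)) :=
    congrArg (_ ≫ ·) (((Category.assoc _ _ _).trans (congrArg (_ ≫ ·) e1)).trans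
      (Category.comp_id _))
  have r : (swap 1 x).inv.app ⟨n⟩ ≫ ((swap 1 x).hom.app ⟨n⟩ ≫ (tensorLeft x).map (braid (ς n g))) ≫
      (swap 1 x).inv.app ⟨n⟩ = (tensorLeft x).map (braid (ς n g)) ≫ (swap 1 x).inv.app ⟨n⟩ :=
    (Category.assoc _ _ _).symm.trans (congrArg (· ≫ _)
      ((Category.assoc _ _ _).symm.trans ((congrArg (· ≫ _) e2).trans (Category.id_comp _))))
  exact l.symm.trans (h.trans r)

/-- The natural transformation `τ_x(τ_1(F)) ⟶ τ_x(LM(F))`, `v ↦ (g_k - 1) ⊗ v`, for one of the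
first `x` generators. -/
def headInclusion (hc : Coherent a ς) (hr : Reliable a) (F : UBeta ⥤ ModuleCat.{u} K) (x : ℕ)
    (k : Fin x) : (translation _ x).obj ((translation _ 1).obj F) ⟶
      (translation _ x).obj ((longMoody K hc).obj F) where
  app n := ModuleCat.ofHom
    (AugTensor.gen (freeRep ς F (x + n.strands)) (Fin.castAdd n.strands k))
  naturality n n' φ := by
    refine ModuleCat.hom_ext (LinearMap.ext fun v => ?_)
    refine Eq.symm ((AugTensor.map_gen (ρ' := freeRep ς F (x + n'.strands))
      (freeMap hc ((tensorLeft x).map φ)) (F.map ((tensorLeft 1).map ((tensorLeft x).map φ))).hom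
        (freeRep_tensorLeft_map hc F _) _ _).trans ?_)
    -- Reliability enters here: id_x ♮ φ fixes the generator of index k, so this copy is stable
    -- under the functor.
    exact congrArg (fun g => AugTensor.tmul (freeRep ς F (x + n'.strands)) (augSub K g)
      ((F.map ((tensorLeft 1).map ((tensorLeft x).map φ))).hom v)) (hr.freeMap_tensorLeft hc x φ k)

/-- The inverse braiding intertwines the action of F_n on F(x+1+n) with that of the last n
generators of F_{x+n} on F(1+x+n). This equivariance makes `tailInclusion` well defined. -/
theorem Coherent.freeRep_swap_inv (hc : Coherent a ς) (F : UBeta ⥤ ModuleCat.{u} K) (x : ℕ)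
    (n : UBeta) (g : FreeGroup (Fin n.strands)) (v : F.obj ⟨x + (1 + n.strands)⟩) :
    (F.map ((swap 1 x).inv.app n)).hom (freeRep ς ((translation _ x).obj F) n.strands g v) =
      freeRep ς F (x + n.strands) (freeMap hc ((unitTensor x).app n) g)
        ((F.map ((swap 1 x).inv.app n)).hom v) := by
  have h := congrArg (fun χ => (F.map χ).hom v) (hc.swap_inv_comp_braid x n.strands g)
  have h1 := congrArg (fun χ => χ.hom v) (F.map_comp
    ((tensorLeft x).map (braid (ς n.strands g))) ((swap 1 x).inv.app n))
  have h2 := congrArg (fun χ => χ.hom v) (F.map_comp ((swap 1 x).inv.app n)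
    (braid (ς (x + n.strands) (freeMap hc ((unitTensor x).app n) g))))
  exact h1.symm.trans (h.symm.trans h2)

/-- The natural transformation `LM(τ_x(F)) ⟶ τ_x(LM(F))`. -/
def tailInclusion (hc : Coherent a ς) (F : UBeta ⥤ ModuleCat.{u} K) (x : ℕ) :
    (longMoody K hc).obj ((translation _ x).obj F) ⟶
      (translation _ x).obj ((longMoody K hc).obj F) where
  app n := ModuleCat.ofHom (AugTensor.map (ρ := freeRep ς ((translation _ x).obj F) n.strands)
    (ρ' := freeRep ς F (x + n.strands)) (freeMap hc ((unitTensor x).app n))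
    (F.map ((swap 1 x).inv.app n)).hom (hc.freeRep_swap_inv F x n))
  naturality n n' φ := by
    refine ModuleCat.hom_ext (AugTensor.hom_ext fun i v => ?_)
    change AugTensor.tmul _ (augMap (freeMap hc ((unitTensor x).app n')) (augMap (freeMap hc φ) i))
      ((F.map ((tensorLeft x).map ((tensorLeft 1).map φ)) ≫ F.map ((swap 1 x).inv.app n')).hom v) =
      AugTensor.tmul _ (augMap (freeMap hc ((tensorLeft x).map φ))
        (augMap (freeMap hc ((unitTensor x).app n)) i))
      ((F.map ((swap 1 x).inv.app n) ≫ F.map ((tensorLeft 1).map ((tensorLeft x).map φ))).hom v)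
    -- The ideal factor uses naturality of ι_x ♮ -, and the module factor that of the braiding.
    have e1 : φ ≫ (unitTensor x).app n' = (unitTensor x).app n ≫ (tensorLeft x).map φ :=
      (unitTensor x).naturality φ
    have e2 : (tensorLeft x).map ((tensorLeft 1).map φ) ≫ (swap 1 x).inv.app n' =
      (swap 1 x).inv.app n ≫ (tensorLeft 1).map ((tensorLeft x).map φ) :=
      (swap 1 x).inv.naturality φ
    have e3 := congrArg (fun χ => (F.map χ).hom v) e2
    have e4 := congrArg (fun χ => χ.hom v) (F.map_comp ((tensorLeft x).map ((tensorLeft 1).map φ))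
      ((swap 1 x).inv.app n'))
    have e5 := congrArg (fun χ => χ.hom v) (F.map_comp ((swap 1 x).inv.app n)
      ((tensorLeft 1).map ((tensorLeft x).map φ)))
    have e6 : augMap (K := K) (freeMap hc ((unitTensor x).app n')) (augMap (freeMap hc φ) i) =
        augMap (freeMap hc ((tensorLeft x).map φ))
          (augMap (freeMap hc ((unitTensor x).app n)) i) := by
      rw [← augMap_comp, ← augMap_comp, ← freeMap_comp, ← freeMap_comp]
      exact congrArg (fun χ => augMap (freeMap hc χ) i) e1
    exact congrArg₂ (AugTensor.tmul _) e6 (e4.symm.trans (e3.trans e5))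

/-- On the module factor, id_1 ♮ (ι_x ♮ id_n) is ι_x ♮ id_{1+n} followed by the inverse braiding.
Both sides act alike on the ideal factor. -/
theorem toTranslation_longMoody (hc : Coherent a ς) (F : UBeta ⥤ ModuleCat.{u} K) (x : ℕ) :
    toTranslation x ((longMoody K hc).obj F) =
      (longMoody K hc).map (toTranslation x F) ≫ tailInclusion hc F x := by
  ext1
  funext n
  refine ModuleCat.hom_ext (AugTensor.hom_ext fun i v => ?_)
  have e : (tensorLeft 1).map ((unitTensor x).app n) =
      (unitTensor x).app ((tensorLeft 1).obj n) ≫ (swap 1 x).inv.app n := by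
    rw [← tensorLeft_map_unitTensor 1 x n]
    exact ((Category.assoc _ _ _).trans ((congrArg (_ ≫ ·) ((swap 1 x).hom_inv_id_app n)).trans
      (Category.comp_id _))).symm
  have e1 := congrArg (fun χ => (F.map χ).hom v) e
  have e2 := congrArg (fun χ => χ.hom v) (F.map_comp ((unitTensor x).app ((tensorLeft 1).obj n))
    ((swap 1 x).inv.app n))
  change AugTensor.tmul _ (augMap (freeMap hc ((unitTensor x).app n)) i) _ =
    AugTensor.tmul _ (augMap (freeMap hc ((unitTensor x).app n)) (augMap (MonoidHom.id _) i)) _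
  rw [augMap_id]
  exact congrArg (AugTensor.tmul _ _) (e1.trans e2)

theorem tailInclusion_gen (hc : Coherent a ς) (F : UBeta ⥤ ModuleCat.{u} K) (x : ℕ) (n : UBeta)
    (i : Fin n.strands) (v : F.obj ⟨x + (1 + n.strands)⟩) :
    ((tailInclusion hc F x).app n).hom
      (AugTensor.gen (freeRep ς ((translation _ x).obj F) n.strands) i v) =
      AugTensor.gen (freeRep ς F (x + n.strands)) (Fin.natAdd x i)
        ((F.map ((swap 1 x).inv.app n)).hom v) := by
  refine (AugTensor.map_gen (ρ := freeRep ς ((translation _ x).obj F) n.strands)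
    (ρ' := freeRep ς F (x + n.strands)) _ _ (hc.freeRep_swap_inv F x n) i v).trans ?_
  have e : freeMap hc ((unitTensor x).app n) (FreeGroup.of i) =
      FreeGroup.of (Fin.natAdd x i) := by
    refine (freeMap_unitTensor hc x n.strands _).trans ((freeLast_of _ _).trans ?_)
    refine congrArg _ (Fin.ext ?_)
    simp
  exact congrArg (fun g => AugTensor.tmul (freeRep ς F (x + n.strands)) (augSub K g)
    ((F.map ((swap 1 x).inv.app n)).hom v)) e

theorem map_swap_inv_hom (F : UBeta ⥤ ModuleCat.{u} K) (x : ℕ) (n : UBeta)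
    (v : F.obj ⟨1 + (x + n.strands)⟩) :
    (F.map ((swap 1 x).inv.app n)).hom ((F.map ((swap 1 x).hom.app n)).hom v) = v := by
  have h := congrArg (fun χ => χ.hom v)
    ((F.mapIso ((swap 1 x).app n)).hom_inv_id)
  exact h

theorem map_swap_hom_inv (F : UBeta ⥤ ModuleCat.{u} K) (x : ℕ) (n : UBeta)
    (v : F.obj ⟨x + (1 + n.strands)⟩) :
    (F.map ((swap 1 x).hom.app n)).hom ((F.map ((swap 1 x).inv.app n)).hom v) = v := by
  have h := congrArg (fun χ => χ.hom v)
    ((F.mapIso ((swap 1 x).app n)).inv_hom_id)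
  exact h

theorem gen_natAdd (hc : Coherent a ς) (F : UBeta ⥤ ModuleCat.{u} K) (x : ℕ) (n : UBeta)
    (i : Fin n.strands) (v : F.obj ⟨1 + (x + n.strands)⟩) :
    AugTensor.gen (freeRep ς F (x + n.strands)) (Fin.natAdd x i) v =
      ((tailInclusion hc F x).app n).hom
        (AugTensor.gen (freeRep ς ((translation _ x).obj F) n.strands) i
          ((F.map ((swap 1 x).hom.app n)).hom v)) := by
  refine Eq.trans ?_ (tailInclusion_gen hc F x n i _).symm
  rw [map_swap_inv_hom]

/-- A generator of F_{x+n} is among the first x or the last n, so the inclusions are jointly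
epimorphic. -/
theorem hom_ext_head_tail (hc : Coherent a ς) (hr : Reliable a) {F : UBeta ⥤ ModuleCat.{u} K}
    {x : ℕ} {n : UBeta} {P : ModuleCat.{u} K}
    {f f' : ((translation _ x).obj ((longMoody K hc).obj F)).obj n ⟶ P}
    (h : ∀ k, (headInclusion hc hr F x k).app n ≫ f = (headInclusion hc hr F x k).app n ≫ f')
    (htail : (tailInclusion hc F x).app n ≫ f = (tailInclusion hc F x).app n ≫ f') : f = f' := by
  refine ModuleCat.hom_ext (AugTensor.hom_ext_gen
    (ρ := freeRep ς F (x + n.strands)) fun j => LinearMap.ext fun v => ?_)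
  induction j using Fin.addCases with
  | left k => exact congrArg (fun χ => χ.hom v) (h k)
  | right i =>
    have e := gen_natAdd hc F x n i v
    refine (congrArg f.hom e).trans (Eq.trans ?_ (congrArg f'.hom e).symm)
    exact congrArg (fun χ => χ.hom (AugTensor.gen
      (freeRep ς ((translation _ x).obj F) n.strands) i
        ((F.map ((swap 1 x).hom.app n)).hom v))) htail

/-- The components of the projection onto the summand of index `k` of `τ_x(LM(F))`. -/
def headProjectionApp (hc : Coherent a ς) (F : UBeta ⥤ ModuleCat.{u} K) (x : ℕ) (k : Fin x)
    (n : UBeta) : ((translation _ x).obj ((longMoody K hc).obj F)).obj n ⟶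
      ((translation _ x).obj ((translation _ 1).obj F)).obj n :=
  ModuleCat.ofHom (AugTensor.coord (freeRep ς F (x + n.strands)) (Fin.castAdd n.strands k))

/-- The components of the projection `τ_x(LM(F)) ⟶ LM(τ_x(F))`. -/
def tailProjectionApp (hc : Coherent a ς) (F : UBeta ⥤ ModuleCat.{u} K) (x : ℕ) (n : UBeta) :
    ((translation _ x).obj ((longMoody K hc).obj F)).obj n ⟶
      ((longMoody K hc).obj ((translation _ x).obj F)).obj n :=
  ModuleCat.ofHom (∑ i : Fin n.strands,
    (AugTensor.gen (freeRep ς ((translation _ x).obj F) n.strands) i ∘ₗ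
      (F.map ((swap 1 x).hom.app n)).hom) ∘ₗ
        AugTensor.coord (freeRep ς F (x + n.strands)) (Fin.natAdd x i))

theorem tailProjectionApp_apply (hc : Coherent a ς) (F : UBeta ⥤ ModuleCat.{u} K) (x : ℕ)
    (n : UBeta) (y : AugTensor (freeRep ς F (x + n.strands))) :
    (tailProjectionApp hc F x n).hom y = ∑ i : Fin n.strands,
      AugTensor.gen (freeRep ς ((translation _ x).obj F) n.strands) i
        ((F.map ((swap 1 x).hom.app n)).hom
          (AugTensor.coord (freeRep ς F (x + n.strands)) (Fin.natAdd x i) y)) :=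
  LinearMap.sum_apply (M := AugTensor (freeRep ς F (x + n.strands)))
    (M₂ := AugTensor (freeRep ς ((translation _ x).obj F) n.strands)) _ _ y

theorem headInclusion_headProjectionApp (hc : Coherent a ς) (hr : Reliable a)
    (F : UBeta ⥤ ModuleCat.{u} K) (x : ℕ) (k l : Fin x) (n : UBeta) :
    (headInclusion hc hr F x k).app n ≫ headProjectionApp hc F x l n =
      if l = k then 𝟙 _ else 0 := by
  split_ifs with h
  · subst h
    refine ModuleCat.hom_ext (LinearMap.ext fun v => ?_)
    exact AugTensor.coord_gen_self (freeRep ς F (x + n.strands)) _ v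
  · refine ModuleCat.hom_ext (LinearMap.ext fun v => ?_)
    exact AugTensor.coord_gen_of_ne (freeRep ς F (x + n.strands)) (by simpa using h) v

theorem headInclusion_tailProjectionApp (hc : Coherent a ς) (hr : Reliable a)
    (F : UBeta ⥤ ModuleCat.{u} K) (x : ℕ) (k : Fin x) (n : UBeta) :
    (headInclusion hc hr F x k).app n ≫ tailProjectionApp hc F x n = 0 := by
  refine ModuleCat.hom_ext (LinearMap.ext fun v => ?_)
  refine (tailProjectionApp_apply hc F x n _).trans (Finset.sum_eq_zero fun i _ => ?_)
  have h : AugTensor.coord (freeRep ς F (x + n.strands)) (Fin.natAdd x i)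
      (AugTensor.gen (freeRep ς F (x + n.strands)) (Fin.castAdd n.strands k) v) = 0 :=
    AugTensor.coord_gen_of_ne _ (fun h => by
      have := congrArg Fin.val h
      simp at this
      omega) _
  refine (congrArg (fun w => AugTensor.gen (freeRep ς ((translation _ x).obj F) n.strands) i
        ((F.map ((swap 1 x).hom.app n)).hom w)) h).trans ?_
  exact (congrArg _ (map_zero _)).trans (map_zero _)

theorem tailInclusion_headProjectionApp (hc : Coherent a ς)
    (F : UBeta ⥤ ModuleCat.{u} K) (x : ℕ) (k : Fin x) (n : UBeta) :
    (tailInclusion hc F x).app n ≫ headProjectionApp hc F x k n = 0 := by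
  refine ModuleCat.hom_ext (AugTensor.hom_ext_gen fun i => LinearMap.ext fun v => ?_)
  refine (congrArg (headProjectionApp hc F x k n).hom (tailInclusion_gen hc F x n i v)).trans ?_
  exact AugTensor.coord_gen_of_ne _ (fun h => by
    have := congrArg Fin.val h
    simp at this
    omega) _

theorem tailInclusion_tailProjectionApp (hc : Coherent a ς)
    (F : UBeta ⥤ ModuleCat.{u} K) (x : ℕ) (n : UBeta) :
    (tailInclusion hc F x).app n ≫ tailProjectionApp hc F x n = 𝟙 _ := by
  refine ModuleCat.hom_ext (AugTensor.hom_ext_gen fun i => LinearMap.ext fun v => ?_)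
  refine (congrArg (tailProjectionApp hc F x n).hom (tailInclusion_gen hc F x n i v)).trans ?_
  refine (tailProjectionApp_apply hc F x n _).trans ?_
  rw [Finset.sum_eq_single i]
  · exact congrArg (AugTensor.gen (freeRep ς ((translation _ x).obj F) n.strands) i)
      ((congrArg (F.map ((swap 1 x).hom.app n)).hom (AugTensor.coord_gen_self _ _ _)).trans
        (map_swap_hom_inv F x n v))
  · intro j _ hj
    have h : Fin.natAdd x j ≠ Fin.natAdd x i := by simpa using hj
    refine (congrArg (fun w => AugTensor.gen (freeRep ς ((translation _ x).obj F) n.strands) j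
      ((F.map ((swap 1 x).hom.app n)).hom w)) (AugTensor.coord_gen_of_ne _ h _)).trans ?_
    exact (congrArg _ (map_zero _)).trans (map_zero _)
  · exact fun h => absurd (Finset.mem_univ i) h

/-- The projection of `τ_x(LM(F))` onto its summand `τ_x(τ_1(F))` of index `k`. -/
def headProjection (hc : Coherent a ς) (hr : Reliable a) (F : UBeta ⥤ ModuleCat.{u} K) (x : ℕ)
    (k : Fin x) : (translation _ x).obj ((longMoody K hc).obj F) ⟶
      (translation _ x).obj ((translation _ 1).obj F) where
  app n := headProjectionApp hc F x k n
  naturality n n' φ := by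
    -- Naturality is tested on the inclusions, which are already natural; no formula for the
    -- coordinates of id_x ♮ φ is needed.
    refine hom_ext_head_tail hc hr (fun l => ?_) ?_
    · rw [← NatTrans.naturality_assoc, headInclusion_headProjectionApp, ← Category.assoc,
        headInclusion_headProjectionApp]
      split_ifs
      · rw [Category.comp_id, Category.id_comp]
      · rw [comp_zero, zero_comp]
    · rw [← NatTrans.naturality_assoc, tailInclusion_headProjectionApp, ← Category.assoc,
        tailInclusion_headProjectionApp, comp_zero, zero_comp]

/-- The projection of `τ_x(LM(F))` onto its summand `LM(τ_x(F))`. -/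
def tailProjection (hc : Coherent a ς) (hr : Reliable a) (F : UBeta ⥤ ModuleCat.{u} K) (x : ℕ) :
    (translation _ x).obj ((longMoody K hc).obj F) ⟶
      (longMoody K hc).obj ((translation _ x).obj F) where
  app n := tailProjectionApp hc F x n
  naturality n n' φ := by
    refine hom_ext_head_tail hc hr (fun l => ?_) ?_
    · rw [← NatTrans.naturality_assoc, headInclusion_tailProjectionApp, ← Category.assoc,
        headInclusion_tailProjectionApp, comp_zero, zero_comp]
    · rw [← NatTrans.naturality_assoc, tailInclusion_tailProjectionApp, ← Category.assoc,
        tailInclusion_tailProjectionApp, Category.comp_id, Category.id_comp]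

theorem headInclusion_headProjection (hc : Coherent a ς) (hr : Reliable a)
    (F : UBeta ⥤ ModuleCat.{u} K) (x : ℕ) (k l : Fin x) :
    headInclusion hc hr F x k ≫ headProjection hc hr F x l = if l = k then 𝟙 _ else 0 := by
  ext1
  funext n
  refine (headInclusion_headProjectionApp hc hr F x k l n).trans ?_
  split_ifs <;> rfl

theorem headInclusion_tailProjection (hc : Coherent a ς) (hr : Reliable a)
    (F : UBeta ⥤ ModuleCat.{u} K) (x : ℕ) (k : Fin x) :
    headInclusion hc hr F x k ≫ tailProjection hc hr F x = 0 := by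
  ext1
  funext n
  exact headInclusion_tailProjectionApp hc hr F x k n

theorem tailInclusion_headProjection (hc : Coherent a ς) (hr : Reliable a)
    (F : UBeta ⥤ ModuleCat.{u} K) (x : ℕ) (k : Fin x) :
    tailInclusion hc F x ≫ headProjection hc hr F x k = 0 := by
  ext1
  funext n
  exact tailInclusion_headProjectionApp hc F x k n

theorem tailInclusion_tailProjection (hc : Coherent a ς) (hr : Reliable a)
    (F : UBeta ⥤ ModuleCat.{u} K) (x : ℕ) :
    tailInclusion hc F x ≫ tailProjection hc hr F x = 𝟙 _ := by
  ext1
  funext n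
  exact tailInclusion_tailProjectionApp hc F x n

/-- `τ_x(LM(F))` is the direct sum of `LM(τ_x(F))` and of `x` copies of `τ_x(τ_1(F))`. -/
theorem head_add_tail (hc : Coherent a ς) (hr : Reliable a) (F : UBeta ⥤ ModuleCat.{u} K)
    (x : ℕ) : tailProjection hc hr F x ≫ tailInclusion hc F x +
      ∑ k, headProjection hc hr F x k ≫ headInclusion hc hr F x k = 𝟙 _ := by
  have key : ∀ f : (translation _ x).obj ((longMoody K hc).obj F) ⟶
      (translation _ x).obj ((longMoody K hc).obj F),
      (∀ k, headInclusion hc hr F x k ≫ f = headInclusion hc hr F x k) →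
      tailInclusion hc F x ≫ f = tailInclusion hc F x → f = 𝟙 _ := by
    intro f h h'
    ext1
    funext n
    refine hom_ext_head_tail hc hr (fun k => ?_) ?_
    · exact (congrArg (fun θ => θ.app n) (h k)).trans (Category.comp_id _).symm
    · exact (congrArg (fun θ => θ.app n) h').trans (Category.comp_id _).symm
  refine key _ (fun l => ?_) ?_
  · rw [Preadditive.comp_add, Preadditive.comp_sum, ← Category.assoc,
      headInclusion_tailProjection, zero_comp, zero_add, Finset.sum_eq_single l]
    · rw [← Category.assoc, headInclusion_headProjection, if_pos rfl, Category.id_comp]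
    · intro k _ hk
      rw [← Category.assoc, headInclusion_headProjection, if_neg hk, zero_comp]
    · exact fun h => absurd (Finset.mem_univ l) h
  · rw [Preadditive.comp_add, Preadditive.comp_sum, ← Category.assoc,
      tailInclusion_tailProjection, Category.id_comp, Finset.sum_eq_zero, add_zero]
    intro k _
    rw [← Category.assoc, tailInclusion_headProjection, zero_comp]

end Decomposition

end LongMoody

/-! ### The effect of the Long-Moody functor on the degree. -/

namespace LongMoody

section Degree

variable {a : ∀ n : ℕ, BraidGroup n →* MulAut (FreeGroup (Fin n))}
  {ς : ∀ n : ℕ, FreeGroup (Fin n) →* BraidGroup (1 + n)} {K : Type u} [CommRing K]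

/-- The morphism i_x of LM(F) is LM(i_x), a monomorphism by exactness, followed by a split
monomorphism. -/
theorem isZero_evanescence_longMoody (hc : Coherent a ς) (hr : Reliable a)
    {F : UBeta ⥤ ModuleCat.{u} K} {x : ℕ} (h : IsZero (evanescence x F)) :
    IsZero (evanescence x ((longMoody K hc).obj F)) := by
  have := mono_toTranslation h
  have : IsSplitMono (tailInclusion hc F x) :=
    ⟨⟨⟨tailProjection hc hr F x, tailInclusion_tailProjection hc hr F x⟩⟩⟩
  have : Mono (toTranslation x ((longMoody K hc).obj F)) := by
    rw [toTranslation_longMoody]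
    infer_instance
  exact isZero_kernel_of_mono _

theorem toTranslation_longMoody_headProjection (hc : Coherent a ς) (hr : Reliable a)
    (F : UBeta ⥤ ModuleCat.{u} K) (x : ℕ) (k : Fin x) :
    toTranslation x ((longMoody K hc).obj F) ≫ headProjection hc hr F x k = 0 := by
  rw [toTranslation_longMoody, Category.assoc, tailInclusion_headProjection, comp_zero]

theorem toTranslation_longMoody_tailProjection (hc : Coherent a ς) (hr : Reliable a)
    (F : UBeta ⥤ ModuleCat.{u} K) (x : ℕ) :
    toTranslation x ((longMoody K hc).obj F) ≫ tailProjection hc hr F x ≫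
      (longMoody K hc).map (differenceπ x F) = 0 := by
  rw [toTranslation_longMoody, Category.assoc, ← Category.assoc (tailInclusion hc F x),
    tailInclusion_tailProjection, Category.id_comp, ← Functor.map_comp,
    toTranslation_comp_differenceπ, Functor.map_zero]

/-- By exactness LM(δ_x(F)) is the cokernel of LM(i_x), and `tailInclusion` carries LM(i_x) to i_x
of LM(F), which dies in the difference. -/
theorem exists_longMoody_difference (hc : Coherent a ς) (F : UBeta ⥤ ModuleCat.{u} K) (x : ℕ) :
    ∃ s : (longMoody K hc).obj (difference x F) ⟶ difference x ((longMoody K hc).obj F),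
      (longMoody K hc).map (differenceπ x F) ≫ s =
        tailInclusion hc F x ≫ differenceπ x ((longMoody K hc).obj F) := by
  let S := ShortComplex.mk (toTranslation x F) (differenceπ x F) (toTranslation_comp_differenceπ x F)
  have hS : S.Exact := ShortComplex.exact_cokernel (toTranslation x F)
  have hS' := longMoody_map_exact hc S hS
  have : Epi (S.map (longMoody K hc)).g :=
    inferInstanceAs (Epi ((longMoody K hc).map (differenceπ x F)))
  have h0 : (S.map (longMoody K hc)).f ≫ tailInclusion hc F x ≫
      differenceπ x ((longMoody K hc).obj F) = 0 := by
    have h := toTranslation_comp_differenceπ x ((longMoody K hc).obj F)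
    rw [toTranslation_longMoody, Category.assoc] at h
    exact h
  exact ⟨hS'.desc _ h0, hS'.g_desc _ h0⟩

/-- `δ_x(LM(F))` is very strong polynomial if `LM(δ_x(F))` and `τ_x(τ_1(F))` are. -/
theorem IsVeryStrongPolynomialLT.difference_longMoody (hc : Coherent a ς) (hr : Reliable a)
    {m x : ℕ} {F : UBeta ⥤ ModuleCat.{u} K}
    (h : IsVeryStrongPolynomialLT m
      ((LongMoody.translation _ x).obj ((LongMoody.translation _ 1).obj F)))
    (h' : IsVeryStrongPolynomialLT m ((longMoody K hc).obj (difference x F))) :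
    IsVeryStrongPolynomialLT m (difference x ((longMoody K hc).obj F)) := by
  obtain ⟨s, hs⟩ := exists_longMoody_difference hc F x
  have e1 : differenceπ x ((longMoody K hc).obj F) ≫
      differenceDesc x (tailProjection hc hr F x ≫ (longMoody K hc).map (differenceπ x F))
        (toTranslation_longMoody_tailProjection hc hr F x) ≫ s =
      tailProjection hc hr F x ≫ tailInclusion hc F x ≫ differenceπ x _ := by
    rw [← Category.assoc, differenceπ_desc, Category.assoc, hs]
  have e2 : ∀ k, differenceπ x ((longMoody K hc).obj F) ≫
      differenceDesc x (headProjection hc hr F x k)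
        (toTranslation_longMoody_headProjection hc hr F x k) ≫
          headInclusion hc hr F x k ≫ differenceπ x _ =
      headProjection hc hr F x k ≫ headInclusion hc hr F x k ≫ differenceπ x _ := fun k => by
    rw [← Category.assoc, differenceπ_desc]
  -- The index `none` stands for LM(δ_x(F)), the others for the x copies of τ_x(τ_1(F)).
  refine .of_sum (ι := Option (Fin x))
    (X := fun o => o.elim ((longMoody K hc).obj (difference x F))
      fun _ => (translation _ x).obj ((translation _ 1).obj F))
    (fun o => match o with
      | none => differenceDesc x (tailProjection hc hr F x ≫ (longMoody K hc).map (differenceπ x F))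
          (toTranslation_longMoody_tailProjection hc hr F x)
      | some k => differenceDesc x (headProjection hc hr F x k)
          (toTranslation_longMoody_headProjection hc hr F x k))
    (fun o => match o with
      | none => s
      | some k => headInclusion hc hr F x k ≫ differenceπ x _) ?_ fun o => ?_
  · rw [Fintype.sum_option]
    -- On τ_x(LM(F)) the relation is the splitting `head_add_tail`, followed by the projection to
    -- the difference.
    refine (cancel_epi (differenceπ x _)).mp ?_
    have h1 := congrArg (· ≫ differenceπ x ((longMoody K hc).obj F)) (head_add_tail hc hr F x)
    simp only [Preadditive.add_comp, Preadditive.sum_comp, Category.assoc] at h1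
    simp only [Preadditive.comp_add, Preadditive.comp_sum]
    rw [Category.comp_id]
    refine Eq.trans ?_ (h1.trans (Category.id_comp _))
    exact congrArg₂ (· + ·) e1 (Finset.sum_congr rfl fun k _ => e2 k)
  · cases o with
    | none => exact h'
    | some k => exact h

/-- The bound rises by one because δ_x(LM(F)) contains translates of F itself, not only of its
differences. -/
theorem IsVeryStrongPolynomialLT.longMoody_obj (hc : Coherent a ς) (hr : Reliable a) {m : ℕ}
    {F : UBeta ⥤ ModuleCat.{u} K} (hF : IsVeryStrongPolynomialLT m F) :
    IsVeryStrongPolynomialLT (m + 1) ((longMoody K hc).obj F) := by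
  induction m generalizing F with
  | zero => exact .of_isZero (Functor.map_isZero _ hF)
  | succ m ih =>
    exact isVeryStrongPolynomialLT_succ.mpr fun x =>
      ⟨isZero_evanescence_longMoody hc hr (hF.2 x).1,
        .difference_longMoody hc hr ((hF.translation_obj 1).translation_obj x) (ih (hF.2 x).2)⟩

theorem IsVeryStrongPolynomialLT.of_longMoody_obj (hc : Coherent a ς) (hr : Reliable a) {m M : ℕ}
    {F : UBeta ⥤ ModuleCat.{u} K} (hF : IsVeryStrongPolynomialLT M F)
    (h : IsVeryStrongPolynomialLT (m + 1) ((longMoody K hc).obj F)) :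
    IsVeryStrongPolynomialLT m F := by
  -- For x = 1 there is one head summand, so τ_1(τ_1(F)) is a retract of δ_1(LM(F)). The two
  -- translations are then removed one after the other.
  refine (hF.of_translation 1 ((hF.translation_obj 1).of_translation 1
    ((h.2 1).2.of_retract (headInclusion hc hr F 1 0 ≫ differenceπ 1 _)
      (differenceDesc 1 (headProjection hc hr F 1 0)
        (toTranslation_longMoody_headProjection hc hr F 1 0)) ?_)))
  rw [Category.assoc, differenceπ_desc, headInclusion_headProjection, if_pos rfl]

end Degree

end LongMoody

theorem theoremB {K : Type u} [CommRing K]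
    (a : ∀ n : ℕ, LongMoody.BraidGroup n →* MulAut (FreeGroup (Fin n)))
    (ς : ∀ n : ℕ, FreeGroup (Fin n) →* LongMoody.BraidGroup (1 + n))
    (hc : LongMoody.Coherent a ς) (hr : LongMoody.Reliable a)
    (F : LongMoody.UBeta ⥤ ModuleCat.{u} K) (hF : ¬ IsZero F)
    (d : ℕ) (hd : LongMoody.HasVeryStrongDegree F d) :
    LongMoody.HasVeryStrongDegree ((LongMoody.longMoody K hc).obj F) (d + 1) := by
  have hFd : LongMoody.IsVeryStrongPolynomialLT (d + 1) F := hd.1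
  refine ⟨hFd.longMoody_obj hc hr, fun e he => ?_⟩
  have h : LongMoody.IsVeryStrongPolynomialLT e F := hFd.of_longMoody_obj hc hr he
  -- For e = 0 the bound would make F zero. This case has to be excluded by hypothesis, since LM of
  -- the zero functor is zero.
  cases e with
  | zero => exact absurd h hF
  | succ e => exact Nat.succ_le_succ (hd.2 h)
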